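/- Let $G$ be a discrete group, $n\ge 1$, and let $\alpha\in Z^2(G;S^1)$ be a normalized $2$-cocycle ($\alpha(1,1)=1$, trivial action on $S^1$) with values in the subgroup $\mathbb Z/n\subset S^1$ of $n$-th roots of unity. Let $$1\to\mathbb Z/n\to G_\alpha\xrightarrow{\ \rho\ }G\to 1$$ be the associated central extension: $G_\alpha=G\times\mathbb Z/n$ with $(g,s)(h,t)=(gh,\alpha(g,h)st)$. All representations are on finite-dimensional complex vector spaces. For a finite subgroup $H\le G$ let $R_\alpha(H)$ be the Grothendieck group of isomorphism classes of $\alpha$-twisted representations of $H$, i.e. maps $P:H\to GL(V)$ with $P(1)=1$ and $P(x)P(y)=\alpha(x,y)P(xy)$. For a finite subgroup $K\le G_\alpha$ let $R_1(K)$ be the Grothendieck group of isomorphism classes of $1$-central representations of $K$, i.e. homomorphisms $P:K\to GL(V)$ in which every $z\in K\cap\mathbb Z/n$ acts as multiplication by $z\in S^1$. With restriction of representations these define contravariant functors $\mathcal R_\alpha^G$ and $\mathcal R_1^{G_\alpha}$ on the orbit categories of finite subgroups of $G$ and of $G_\alpha$: a map $xH\mapsto xgK$ acts by $P\mapsto\big(h\mapsto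 P(g^{-1}hg)\big)$ for $\mathcal R_1^{G_\alpha}$ and by $P\mapsto\big(h\mapsto \alpha(h,g)\,\alpha(g,g^{-1}hg)^{-1}P(g^{-1}hg)\big)$ for $\mathcal R_\alpha^G$. A $G$-CW-complex is a CW-complex with a $G$-action permuting the cells such that a cell sent to itself is fixed pointwise; it is proper if all cell stabilizers are finite. A model for $\underline{E}G$ is a proper $G$-CW-complex to which every proper $G$-CW-complex has a $G$-map, unique up to $G$-homotopy. For a contravariant functor $M$ from the orbit category of finite subgroups to abelian groups, $H_G^*(X;M)$ is the cohomology of the complex whose $i$-th group consists of the natural transformations from $G/H\mapsto C_i(X^H)$ (cellular chains) to $M$. Let $X$ be a model for $\underline{E}G$. Then $X$ with the action of $G_\alpha$ via $\rho$ is a model for $\underline{E}G_\alpha$, and $\rho$ induces an isomorphism of abelian groups $$\rho^*:H_G^i(\underline{E}G;\mathcal R_\alpha^G)\xrightarrow{\ \cong\ }H_{G_\alpha}^i(\underline{E}G_\alpha;\mathcal R_1^{G_\alpha})\qquad\text{for every } i\ge 0,$$ both sides being computed on $X$. Here $\rho^*$ is induced by the cochain map sending a natural transformation $c$ to the composites $$C_i(X^K)=C_i(X^{\rho(K)})\xrightarrow{\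 c\ }R_\alpha(\rho(K))\to R_1(K),$$ for finite $K\le G_\alpha$, where the last map sends $P$ to the representation $(h,t)\mapsto t\,P(h)$ of $K$. -/

import Mathlib

open CategoryTheory

universe u v w

noncomputable section

namespace Bredon

/-! ### Isomorphism classes of families of operators -/

/-- A family of linear operators on some `ℂ^d`, indexed by `S`. -/
structure OpFamily (S : Type u) where
  dim : ℕ
  op : S → Module.End ℂ (Fin dim → ℂ)

/-- Two families of operators indexed by `S` are intertwined by a linear isomorphism. -/
def Intertwined {S : Type u} {V W : Type} [AddCommGroup V] [Module ℂ V] [AddCommGroup W]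
    [Module ℂ W] (p : S → Module.End ℂ V) (q : S → Module.End ℂ W) : Prop :=
  ∃ e : V ≃ₗ[ℂ] W, ∀ s v, e (p s v) = q s (e v)

namespace Intertwined

variable {S : Type u} {V W U V' W' : Type}
  [AddCommGroup V] [Module ℂ V] [AddCommGroup W] [Module ℂ W] [AddCommGroup U] [Module ℂ U]
  [AddCommGroup V'] [Module ℂ V'] [AddCommGroup W'] [Module ℂ W']
  {p : S → Module.End ℂ V} {q : S → Module.End ℂ W} {r : S → Module.End ℂ U}
  {p' : S → Module.End ℂ V'} {q' : S → Module.End ℂ W'}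

theorem refl (p : S → Module.End ℂ V) : Intertwined p p := ⟨LinearEquiv.refl ℂ V, fun _ _ => rfl⟩

theorem symm (h : Intertwined p q) : Intertwined q p := by
  obtain ⟨e, he⟩ := h
  exact ⟨e.symm, fun s v => by rw [LinearEquiv.symm_apply_eq, he, e.apply_symm_apply]⟩

theorem trans (h : Intertwined p q) (h' : Intertwined q r) : Intertwined p r := by
  obtain ⟨e, he⟩ := h
  obtain ⟨f, hf⟩ := h'
  exact ⟨e.trans f, fun s v => by simp [he, hf]⟩

theorem prod (h : Intertwined p p') (h' : Intertwined q q') :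
    Intertwined (fun s => (p s).prodMap (q s)) (fun s => (p' s).prodMap (q' s)) := by
  obtain ⟨e, he⟩ := h
  obtain ⟨f, hf⟩ := h'
  exact ⟨e.prodCongr f, fun s v => by simp [he, hf]⟩

theorem prod_comm (p : S → Module.End ℂ V) (q : S → Module.End ℂ W) :
    Intertwined (fun s => (p s).prodMap (q s)) (fun s => (q s).prodMap (p s)) :=
  ⟨LinearEquiv.prodComm ℂ V W, fun _ _ => rfl⟩

theorem prod_assoc (p : S → Module.End ℂ V) (q : S → Module.End ℂ W) (r : S → Module.End ℂ U) :
    Intertwined (fun s => ((p s).prodMap (q s)).prodMap (r s))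
      (fun s => (p s).prodMap ((q s).prodMap (r s))) :=
  ⟨LinearEquiv.prodAssoc ℂ V W U, fun _ _ => rfl⟩

theorem prod_unique [Subsingleton V] (p : S → Module.End ℂ V) (q : S → Module.End ℂ W) :
    Intertwined (fun s => (p s).prodMap (q s)) q :=
  ⟨{ LinearMap.snd ℂ V W with
      invFun := fun w => (0, w)
      left_inv := fun _ => Prod.ext (Subsingleton.elim _ _) rfl
      right_inv := fun _ => rfl }, fun _ _ => rfl⟩

/-- Relabelling and rescaling preserve intertwining. -/
theorem pull {T : Type v} (h : Intertwined p q) (j : T → S) (c : T → ℂ) :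
    Intertwined (fun t => c t • p (j t)) (fun t => c t • q (j t)) := by
  obtain ⟨e, he⟩ := h
  exact ⟨e, fun s v => by simp [he]⟩

end Intertwined

namespace OpFamily

variable {S : Type u}

/-- Isomorphism of families of operators. -/
instance setoid (S : Type u) : Setoid (OpFamily S) where
  r P Q := Intertwined P.op Q.op
  iseqv := ⟨fun P => .refl P.op, .symm, .trans⟩

/-- The identification `ℂ^(m+n) = ℂ^m × ℂ^n`. -/
def splitEquiv (m n : ℕ) : (Fin (m + n) → ℂ) ≃ₗ[ℂ] (Fin m → ℂ) × (Fin n → ℂ) :=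
  (LinearEquiv.funCongrLeft ℂ ℂ finSumFinEquiv).trans (LinearEquiv.sumArrowLequivProdArrow _ _ ℂ ℂ)

/-- Direct sum of families of operators. -/
def add (P Q : OpFamily S) : OpFamily S where
  dim := P.dim + Q.dim
  op s := (splitEquiv P.dim Q.dim).symm.conj ((P.op s).prodMap (Q.op s))

theorem add_intertwined (P Q : OpFamily S) :
    Intertwined (P.add Q).op (fun s => (P.op s).prodMap (Q.op s)) :=
  ⟨splitEquiv P.dim Q.dim, fun _ _ => (splitEquiv P.dim Q.dim).apply_symm_apply _⟩

/-- The family on the zero space. -/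
def zero (S : Type u) : OpFamily S := ⟨0, fun _ => 0⟩

/-- The family `t ↦ c t • P (j t)`. -/
def pull {T : Type v} (j : T → S) (c : T → ℂ) (P : OpFamily S) : OpFamily T :=
  ⟨P.dim, fun t => c t • P.op (j t)⟩

theorem pull_add {T : Type v} (j : T → S) (c : T → ℂ) (P Q : OpFamily S) :
    (pull j c (P.add Q)) ≈ (pull j c P).add (pull j c Q) := by
  refine Intertwined.trans ((add_intertwined P Q).pull j c) (Intertwined.trans ?_
    (add_intertwined (pull j c P) (pull j c Q)).symm)
  exact ⟨LinearEquiv.refl ℂ _, fun _ _ => rfl⟩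

end OpFamily

/-- Isomorphism classes of families of operators on finite-dimensional complex vector spaces. -/
def OpClass (S : Type u) : Type u := Quotient (OpFamily.setoid S)

namespace OpClass

variable {S : Type u}

/-- The isomorphism class of a family of operators. -/
def mk (P : OpFamily S) : OpClass S := Quotient.mk _ P

theorem mk_eq_mk {P Q : OpFamily S} : mk P = mk Q ↔ Intertwined P.op Q.op := Quotient.eq

instance : Zero (OpClass S) := ⟨mk (OpFamily.zero S)⟩

instance : Add (OpClass S) :=
  ⟨Quotient.map₂ OpFamily.add fun P P' h Q Q' h' =>
    (P.add_intertwined Q).trans ((h.prod h').trans (P'.add_intertwined Q').symm)⟩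

/-- Isomorphism classes form a commutative monoid under direct sum. -/
instance : AddCommMonoid (OpClass S) where
  nsmul := nsmulRec
  add_assoc := by
    rintro ⟨P⟩ ⟨Q⟩ ⟨R⟩
    refine Quotient.sound ?_
    exact ((P.add Q).add_intertwined R).trans ((((P.add_intertwined Q).prod (.refl R.op)).trans
      (.prod_assoc _ _ _)).trans (((Intertwined.refl P.op).prod (Q.add_intertwined R).symm).trans
        (P.add_intertwined (Q.add R)).symm))
  zero_add := by
    rintro ⟨P⟩
    refine Quotient.sound ?_
    have : Subsingleton (Fin (OpFamily.zero S).dim → ℂ) :=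
      inferInstanceAs (Subsingleton (Fin 0 → ℂ))
    exact ((OpFamily.zero S).add_intertwined P).trans (.prod_unique _ _)
  add_zero := by
    rintro ⟨P⟩
    refine Quotient.sound ?_
    have : Subsingleton (Fin (OpFamily.zero S).dim → ℂ) :=
      inferInstanceAs (Subsingleton (Fin 0 → ℂ))
    exact (P.add_intertwined (OpFamily.zero S)).trans ((Intertwined.prod_comm _ _).trans
      (.prod_unique _ _))
  add_comm := by
    rintro ⟨P⟩ ⟨Q⟩
    refine Quotient.sound ?_
    exact (P.add_intertwined Q).trans ((Intertwined.prod_comm _ _).trans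
      (Q.add_intertwined P).symm)

theorem mk_add (P Q : OpFamily S) : mk (P.add Q) = mk P + mk Q := rfl

theorem mk_zero : mk (OpFamily.zero S) = 0 := rfl

/-- The map on isomorphism classes sending `P` to `t ↦ c t • P (j t)`. -/
def pull {T : Type v} (j : T → S) (c : T → ℂ) : OpClass S →+ OpClass T where
  toFun := Quotient.map (OpFamily.pull j c) fun _ _ h => Intertwined.pull h j c
  map_zero' := Quotient.sound ⟨LinearEquiv.refl ℂ _, fun _ _ => Subsingleton.elim (α := Fin 0 → ℂ) _ _⟩
  map_add' := by
    rintro ⟨P⟩ ⟨Q⟩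
    exact Quotient.sound (OpFamily.pull_add j c P Q)

theorem pull_mk {T : Type v} (j : T → S) (c : T → ℂ) (P : OpFamily S) :
    pull j c (mk P) = mk (P.pull j c) := rfl

end OpClass

theorem OpClass.pull_pull {S : Type u} {T : Type v} {U : Type w} (j : T → S) (c : T → ℂ) (i : U → T)
    (b : U → ℂ) (x : OpClass S) :
    OpClass.pull i b (OpClass.pull j c x) = OpClass.pull (j ∘ i) (fun u => b u * c (i u)) x := by
  obtain ⟨P⟩ := x
  exact congrArg (fun f => OpClass.mk ⟨P.dim, f⟩) (funext fun _ => smul_smul _ _ _)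

theorem OpClass.pull_eq_self {S : Type u} (j : S → S) (c : S → ℂ) (hj : ∀ s, j s = s)
    (hc : ∀ s, c s = 1) (x : OpClass S) : OpClass.pull j c x = x := by
  obtain ⟨P⟩ := x
  refine congrArg OpClass.mk ?_
  simp [OpFamily.pull, hj, hc]

/-! ### Grothendieck groups -/

section Grothendieck

open Algebra

/-- The homomorphism of Grothendieck groups induced by a homomorphism of commutative monoids. -/
def grMap {A : Type u} {B : Type v} [AddCommMonoid A] [AddCommMonoid B] (f : A →+ B) :
    GrothendieckAddGroup A →+ GrothendieckAddGroup B :=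
  GrothendieckAddGroup.lift ((GrothendieckAddGroup.of (M := B)).comp f)

theorem grMap_of {A : Type u} {B : Type v} [AddCommMonoid A] [AddCommMonoid B] (f : A →+ B)
    (a : A) : grMap f (GrothendieckAddGroup.of a) = GrothendieckAddGroup.of (f a) :=
  DFunLike.congr_fun
    ((GrothendieckAddGroup.lift (M := A)).symm_apply_apply ((GrothendieckAddGroup.of (M := B)).comp f)) a

theorem gr_hom_ext {A : Type u} {B : Type v} [AddCommMonoid A] [AddCommGroup B]
    {f g : GrothendieckAddGroup A →+ B}
    (h : ∀ a, f (GrothendieckAddGroup.of a) = g (GrothendieckAddGroup.of a)) : f = g :=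
  (GrothendieckAddGroup.lift (M := A)).symm.injective (AddMonoidHom.ext h)

theorem grMap_id {A : Type u} [AddCommMonoid A] {f : A →+ A} (hf : ∀ a, f a = a) :
    grMap f = AddMonoidHom.id _ :=
  gr_hom_ext fun a => by rw [grMap_of, hf, AddMonoidHom.id_apply]

theorem grMap_comp {A : Type u} {B : Type v} {C : Type w} [AddCommMonoid A] [AddCommMonoid B]
    [AddCommMonoid C] (f : A →+ B) (g : B →+ C) : (grMap g).comp (grMap f) = grMap (g.comp f) :=
  gr_hom_ext fun a => by
    rw [AddMonoidHom.comp_apply, grMap_of, grMap_of, grMap_of, AddMonoidHom.comp_apply]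

end Grothendieck

/-- Restriction of `OpClass.pull` to submonoids. -/
def pullOn {S : Type u} {T : Type v} (A : AddSubmonoid (OpClass S)) (B : AddSubmonoid (OpClass T))
    (j : T → S) (c : T → ℂ) (h : ∀ x ∈ A, OpClass.pull j c x ∈ B) : A →+ B :=
  ((OpClass.pull j c).comp A.subtype).codRestrict B fun x => h x x.2

/-- Conjugation `h ↦ g⁻¹hg` as a map `H → K`. -/
def conjMap {G : Type u} [Group G] {H K : Subgroup G} (g : G) (hg : ∀ h ∈ H, g⁻¹ * h * g ∈ K) :
    H → K :=
  fun h => ⟨g⁻¹ * h * g, hg h h.2⟩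

/-! ### Cocycles and twisted representations -/

/-- Normalized `2`-cocycles of the discrete group `G` with values in `S¹` (trivial action). -/
structure Cocycle (G : Type u) [Group G] where
  toFun : G → G → Circle
  cocycle : ∀ g h k, toFun g h * toFun (g * h) k = toFun h k * toFun g (h * k)
  normalized : toFun 1 1 = 1

namespace Cocycle

variable {G : Type u} [Group G]

instance : CoeFun (Cocycle G) fun _ => G → G → Circle := ⟨Cocycle.toFun⟩

variable (α : Cocycle G)

theorem one_left (g : G) : α 1 g = 1 := by
  have := α.cocycle 1 1 g
  simpa [α.normalized] using this

theorem one_right (g : G) : α g 1 = 1 := by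
  have := α.cocycle g 1 1
  simpa [α.normalized] using this

/-- The scalar by which, in the twisted group algebra with basis `u_g` and product
`u_g u_h = α(g,h) u_{gh}`, one has `u_g⁻¹ u_h u_g = conjScalar h g • u_{g⁻¹hg}`. -/
def conjScalar (h g : G) : Circle := α h g / α g (g⁻¹ * h * g)

theorem conjScalar_mul (x y g : G) :
    α.conjScalar x g * α.conjScalar y g * α (g⁻¹ * x * g) (g⁻¹ * y * g) =
      α x y * α.conjScalar (x * y) g := by
  have h1 := α.cocycle x y g
  have h2 := α.cocycle x g (g⁻¹ * y * g)
  have h3 := α.cocycle g (g⁻¹ * x * g) (g⁻¹ * y * g)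
  have e1 : g * (g⁻¹ * y * g) = y * g := by group
  have e2 : g * (g⁻¹ * x * g) = x * g := by group
  have e3 : g⁻¹ * x * g * (g⁻¹ * y * g) = g⁻¹ * (x * y) * g := by group
  rw [e1] at h2
  rw [e2, e3] at h3
  unfold conjScalar
  rw [div_mul_div_comm, div_mul_eq_mul_div, mul_div_assoc', div_eq_div_iff_mul_eq_mul]
  apply mul_left_cancel (a := α (x * g) (g⁻¹ * y * g))
  apply mul_left_cancel (a := α x (y * g))
  calc _ = (α x g * α (x * g) (g⁻¹ * y * g)) * (α y g * α x (y * g)) *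
        (α (g⁻¹ * x * g) (g⁻¹ * y * g) * α g (g⁻¹ * (x * y) * g)) := by ac_rfl
    _ = _ := by rw [h2, ← h1, ← h3]; ac_rfl

theorem conjScalar_comp (h g f : G) :
    α.conjScalar h g * α.conjScalar (g⁻¹ * h * g) f = α.conjScalar h (g * f) := by
  have h1 := α.cocycle h g f
  have h2 := α.cocycle g (g⁻¹ * h * g) f
  have h3 := α.cocycle g f (f⁻¹ * (g⁻¹ * h * g) * f)
  have e1 : g * (g⁻¹ * h * g) = h * g := by group
  have e2 : f * (f⁻¹ * (g⁻¹ * h * g) * f) = g⁻¹ * h * g * f := by group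
  have e3 : (g * f)⁻¹ * h * (g * f) = f⁻¹ * (g⁻¹ * h * g) * f := by group
  rw [e1] at h2
  rw [e2] at h3
  unfold conjScalar
  rw [e3, div_mul_div_comm, div_eq_div_iff_mul_eq_mul]
  apply mul_left_cancel (a := α (h * g) f)
  apply mul_left_cancel (a := α g (g⁻¹ * h * g * f))
  apply mul_left_cancel (a := α g f)
  calc _ = (α h g * α (h * g) f) * (α (g⁻¹ * h * g) f * α g (g⁻¹ * h * g * f)) *
        (α g f * α (g * f) (f⁻¹ * (g⁻¹ * h * g) * f)) := by ac_rfl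
    _ = _ := by rw [h1, ← h2, h3]; ac_rfl

/-- `P : H → End V` is an `α`-twisted representation: `P(1) = 1` and `P(x)P(y) = α(x,y)P(xy)`.
Its values are then automatically in `GL(V)`, see `IsTwisted.isUnit`. -/
structure IsTwisted (H : Subgroup G) {V : Type} [AddCommGroup V] [Module ℂ V]
    (P : H → Module.End ℂ V) : Prop where
  map_one : P 1 = 1
  map_mul : ∀ x y : H, P x * P y = (α (x : G) (y : G) : ℂ) • P (x * y)

namespace IsTwisted

variable {α} {H K : Subgroup G} {V W : Type} [AddCommGroup V] [Module ℂ V] [AddCommGroup W]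
  [Module ℂ W] {P : H → Module.End ℂ V} {Q : H → Module.End ℂ W}

theorem isUnit (hP : α.IsTwisted H P) (x : H) : IsUnit (P x) := by
  have key : ∀ y : H, P y * ((α (y : G) (y⁻¹ : G) : ℂ)⁻¹ • P y⁻¹) = 1 := fun y => by
    rw [mul_smul_comm, hP.map_mul, smul_smul]
    simp [hP.map_one]
  have key' : ∀ y : H, ((α (y⁻¹ : G) (y : G) : ℂ)⁻¹ • P y⁻¹) * P y = 1 := fun y => by
    rw [smul_mul_assoc, hP.map_mul, smul_smul]
    simp [hP.map_one]
  exact isUnit_iff_exists_and_exists.2 ⟨⟨_, key x⟩, ⟨_, key' x⟩⟩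

theorem of_intertwined (hP : α.IsTwisted H P) (h : Intertwined P Q) : α.IsTwisted H Q := by
  obtain ⟨e, he⟩ := h
  have hQ : ∀ s w, Q s w = e (P s (e.symm w)) := fun s w => by simp [he]
  refine ⟨?_, fun x y => ?_⟩
  · ext w; simp [hQ, hP.map_one]
  · ext w
    have := LinearMap.congr_fun (hP.map_mul x y) (e.symm w)
    simp only [Module.End.mul_apply, LinearMap.smul_apply] at this ⊢
    simp [hQ, this]

theorem prod (hP : α.IsTwisted H P) (hQ : α.IsTwisted H Q) :
    α.IsTwisted H (fun s => (P s).prodMap (Q s)) := by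
  refine ⟨?_, fun x y => ?_⟩
  · simp only [hP.map_one, hQ.map_one]; rfl
  · have h1 := hP.map_mul x y
    have h2 := hQ.map_mul x y
    refine LinearMap.ext fun v => ?_
    exact Prod.ext (LinearMap.congr_fun h1 v.1) (LinearMap.congr_fun h2 v.2)

theorem zero (α : Cocycle G) (H : Subgroup G) : α.IsTwisted H (OpFamily.zero H).op := by
  have : Subsingleton (Fin (OpFamily.zero H).dim → ℂ) := inferInstanceAs (Subsingleton (Fin 0 → ℂ))
  exact ⟨Subsingleton.elim _ _, fun _ _ => Subsingleton.elim _ _⟩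

theorem pull {P : K → Module.End ℂ V} (hP : α.IsTwisted K P) (g : G)
    (hg : ∀ h ∈ H, g⁻¹ * h * g ∈ K) :
    α.IsTwisted H (fun h => (α.conjScalar h g : ℂ) • P (conjMap g hg h)) := by
  refine ⟨?_, fun x y => ?_⟩
  · have : conjMap g hg 1 = 1 := Subtype.ext (by simp [conjMap])
    simp [this, hP.map_one, conjScalar, one_left, one_right]
  · have h1 : conjMap g hg x * conjMap g hg y = conjMap g hg (x * y) :=
      Subtype.ext (by simp only [conjMap, Subgroup.coe_mul]; group)
    have h2 := congrArg (Circle.coeHom) (α.conjScalar_mul x y g)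
    simp only [smul_mul_smul_comm, hP.map_mul, h1, smul_smul]
    congr 1

end IsTwisted

/-- The monoid of isomorphism classes of finite-dimensional `α`-twisted representations of `H`. -/
def twistedReps (H : Subgroup G) : AddSubmonoid (OpClass H) where
  carrier := {x | ∃ P : OpFamily H, α.IsTwisted H P.op ∧ OpClass.mk P = x}
  zero_mem' := ⟨OpFamily.zero H, .zero α H, rfl⟩
  add_mem' := by
    rintro _ _ ⟨P, hP, rfl⟩ ⟨Q, hQ, rfl⟩
    exact ⟨P.add Q, (hP.prod hQ).of_intertwined (P.add_intertwined Q).symm, rfl⟩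

/-- The `α`-twisted representation group `R_α(H)`. -/
abbrev TwistedRepGroup (H : Subgroup G) : Type u :=
  Algebra.GrothendieckAddGroup (α.twistedReps H)

variable {H K L : Subgroup G}

/-- Restriction of twisted representations along `h ↦ g⁻¹hg`, on isomorphism classes:
`(g^*P)(h) = P(u_g⁻¹ u_h u_g)`, in terms of the twisted group algebra. -/
def twistedRes (g : G) (hg : ∀ h ∈ H, g⁻¹ * h * g ∈ K) : α.twistedReps K →+ α.twistedReps H :=
  pullOn _ _ (conjMap g hg) (fun h => (α.conjScalar h g : ℂ)) <| by
    rintro _ ⟨P, hP, rfl⟩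
    exact ⟨_, hP.pull g hg, rfl⟩

theorem twistedRes_comp (g f : G) (hg : ∀ h ∈ H, g⁻¹ * h * g ∈ K)
    (hf : ∀ h ∈ K, f⁻¹ * h * f ∈ L) (hgf : ∀ h ∈ H, (g * f)⁻¹ * h * (g * f) ∈ L) :
    (α.twistedRes g hg).comp (α.twistedRes f hf) = α.twistedRes (g * f) hgf := by
  ext x
  refine (OpClass.pull_pull _ _ _ _ _).trans ?_
  have h1 : conjMap f hf ∘ conjMap g hg = conjMap (g * f) hgf :=
    funext fun h => Subtype.ext (by simp only [conjMap, Function.comp]; group)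
  have h2 : ∀ h : H, (α.conjScalar h g : ℂ) * (α.conjScalar (conjMap g hg h) f : ℂ) =
      (α.conjScalar h (g * f) : ℂ) := fun h => by
    rw [← α.conjScalar_comp h g f]; simp [conjMap]
  rw [h1, funext h2]; rfl

theorem twistedRes_eq_id (g : G) (hg1 : g ∈ H) (hg : ∀ h ∈ H, g⁻¹ * h * g ∈ H)
    (x : α.twistedReps H) : α.twistedRes g hg x = x := by
  obtain ⟨_, P, hP, rfl⟩ := x
  refine Subtype.ext (OpClass.mk_eq_mk.2 ?_)
  obtain ⟨u, hu⟩ := hP.isUnit ⟨g, hg1⟩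
  refine ⟨LinearMap.GeneralLinearGroup.generalLinearEquiv ℂ _ u, fun h v => ?_⟩
  have key : P.op ⟨g, hg1⟩ * ((α.conjScalar h g : ℂ) • P.op (conjMap g hg h)) =
      P.op h * P.op ⟨g, hg1⟩ := by
    have e : (⟨g, hg1⟩ : H) * conjMap g hg h = h * ⟨g, hg1⟩ :=
      Subtype.ext (by simp only [conjMap, Subgroup.coe_mul]; group)
    rw [mul_smul_comm, hP.map_mul, hP.map_mul, e, smul_smul]
    congr 1
    simp [conjScalar, conjMap]
  rw [← hu] at key
  exact LinearMap.congr_fun key v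

/-- On isomorphism classes the restriction along `h ↦ g⁻¹hg` depends only on the coset `gK`. -/
theorem twistedRes_congr (g g' : G) (hg : ∀ h ∈ H, g⁻¹ * h * g ∈ K)
    (hg' : ∀ h ∈ H, g'⁻¹ * h * g' ∈ K) (h : g⁻¹ * g' ∈ K) :
    α.twistedRes g hg = α.twistedRes g' hg' := by
  have hk : ∀ x ∈ K, (g⁻¹ * g')⁻¹ * x * (g⁻¹ * g') ∈ K := fun x hx =>
    K.mul_mem (K.mul_mem (K.inv_mem h) hx) h
  have e := α.twistedRes_comp g (g⁻¹ * g') hg hk (by simpa using hg')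
  have : g * (g⁻¹ * g') = g' := by group
  simp only [this] at e
  rw [← e]
  ext x
  simp only [AddMonoidHom.comp_apply]
  rw [α.twistedRes_eq_id _ h]

end Cocycle

/-! ### The central extension -/

/-- The subgroup `ℤ/n ⊂ S¹` of `n`-th roots of unity. -/
abbrev Mu (n : ℕ) : Subgroup Circle := (powMonoidHom n : Circle →* Circle).ker

/-- The cocycle takes values in `ℤ/n ⊂ S¹`. -/
def Cocycle.ValuesIn {G : Type u} [Group G] (α : Cocycle G) (n : ℕ) : Prop :=
  ∀ g h, α g h ∈ Mu n

/-- The set `G × ℤ/n` underlying the extension `G_α`. -/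
@[ext]
structure CentralExt {G : Type u} [Group G] (α : Cocycle G) {n : ℕ} (hα : α.ValuesIn n) where
  base : G
  fiber : Mu n

namespace CentralExt

variable {G : Type u} [Group G] {α : Cocycle G} {n : ℕ} {hα : α.ValuesIn n}

/-- `(g,s)(h,t) = (gh, α(g,h)st)`. -/
instance : Mul (CentralExt α hα) :=
  ⟨fun x y => ⟨x.base * y.base, ⟨α x.base y.base, hα _ _⟩ * (x.fiber * y.fiber)⟩⟩

instance : One (CentralExt α hα) := ⟨⟨1, 1⟩⟩

instance : Inv (CentralExt α hα) :=
  ⟨fun x => ⟨x.base⁻¹, (⟨α x.base⁻¹ x.base, hα _ _⟩ * x.fiber)⁻¹⟩⟩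

theorem base_mul (x y : CentralExt α hα) : (x * y).base = x.base * y.base := rfl
theorem base_one : (1 : CentralExt α hα).base = 1 := rfl
theorem fiber_mul (x y : CentralExt α hα) :
    ((x * y).fiber : Circle) = α x.base y.base * (x.fiber * y.fiber) := rfl
theorem fiber_one : ((1 : CentralExt α hα).fiber : Circle) = 1 := rfl

instance : Group (CentralExt α hα) :=
  Group.ofLeftAxioms
    (fun x y z => CentralExt.ext (mul_assoc _ _ _) <| Subtype.ext <| by
      have := α.cocycle x.base y.base z.base
      simp only [fiber_mul, base_mul]
      calc _ = (α x.base y.base * α (x.base * y.base) z.base) *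
            (x.fiber * y.fiber * z.fiber : Circle) := by ac_rfl
        _ = _ := by rw [this]; ac_rfl)
    (fun x => CentralExt.ext (one_mul _) <| Subtype.ext <| by
      simp [fiber_mul, fiber_one, base_one, α.one_left])
    (fun x => CentralExt.ext (inv_mul_cancel _) <| Subtype.ext <| by
      change (α x.base⁻¹ x.base : Circle) * ((α x.base⁻¹ x.base * (x.fiber : Circle))⁻¹ * x.fiber) = 1
      rw [← mul_assoc, mul_comm _ (x.fiber : Circle), ← mul_assoc, mul_comm (x.fiber : Circle), mul_inv_cancel])

/-- The projection `ρ : G_α → G`. -/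
def proj (hα : α.ValuesIn n) : CentralExt α hα →* G where
  toFun := base
  map_one' := rfl
  map_mul' _ _ := rfl

/-- The inclusion `ℤ/n → G_α`. -/
def incl (hα : α.ValuesIn n) : Mu n →* CentralExt α hα where
  toFun z := ⟨1, z⟩
  map_one' := rfl
  map_mul' z w := CentralExt.ext (one_mul _).symm <| Subtype.ext <| by
    rw [fiber_mul, α.normalized, one_mul]; rfl

/-- The extension `1 → ℤ/n → G_α → G → 1` is exact and central. -/
theorem isCentralExtension (hα : α.ValuesIn n) :
    Function.Injective (incl hα) ∧ Function.Surjective (proj hα) ∧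
      (incl hα).range = (proj hα).ker ∧ (incl hα).range ≤ Subgroup.center _ := by
  refine ⟨fun z w h => congrArg fiber h, fun g => ⟨⟨g, 1⟩, rfl⟩, ?_, ?_⟩
  · ext x
    constructor
    · rintro ⟨z, rfl⟩; rfl
    · intro h; exact ⟨x.fiber, CentralExt.ext (Eq.symm h) rfl⟩
  · rintro _ ⟨z, rfl⟩
    refine Subgroup.mem_center_iff.2 fun x => CentralExt.ext ?_ (Subtype.ext ?_)
    · exact (mul_one _).trans (one_mul _).symm
    · simp only [fiber_mul, incl, MonoidHom.coe_mk, OneHom.coe_mk, α.one_left, α.one_right]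
      rw [mul_comm (x.fiber : Circle)]

/-- For `z ∈ G_α` in the central `ℤ/n`, conjugation by `g` does not change `z`. -/
theorem conj_of_base_eq_one (z g : CentralExt α hα) (hz : z.base = 1) : g⁻¹ * z * g = z := by
  have : z ∈ Subgroup.center (CentralExt α hα) :=
    (isCentralExtension hα).2.2.2 ((isCentralExtension hα).2.2.1 ▸ hz)
  rw [mul_assoc, ← Subgroup.mem_center_iff.1 this g, inv_mul_cancel_left]

/-! ### `1`-central representations -/

/-- `P : K → End V` is a `1`-central representation of `K ≤ G_α`: a representation of `K` in which
the elements of the central `ℤ/n ⊂ S¹` contained in `K` act by scalar multiplication. If `K`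
contains `ℤ/n`, this says that the generator `e^{2πi/n}` acts by multiplication by `e^{2πi/n}`. -/
structure IsOneCentral (K : Subgroup (CentralExt α hα)) {V : Type} [AddCommGroup V] [Module ℂ V]
    (P : K → Module.End ℂ V) : Prop where
  map_one : P 1 = 1
  map_mul : ∀ x y : K, P x * P y = P (x * y)
  central : ∀ (z : Mu n) (hz : incl hα z ∈ K), P ⟨incl hα z, hz⟩ = ((z : Circle) : ℂ) • 1

namespace IsOneCentral

variable {K L : Subgroup (CentralExt α hα)} {V W : Type} [AddCommGroup V] [Module ℂ V]
  [AddCommGroup W] [Module ℂ W] {P : K → Module.End ℂ V} {Q : K → Module.End ℂ W}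

theorem isUnit (hP : IsOneCentral K P) (x : K) : IsUnit (P x) :=
  isUnit_iff_exists_and_exists.2 ⟨⟨P x⁻¹, by rw [hP.map_mul, mul_inv_cancel, hP.map_one]⟩,
    ⟨P x⁻¹, by rw [hP.map_mul, inv_mul_cancel, hP.map_one]⟩⟩

theorem of_intertwined (hP : IsOneCentral K P) (h : Intertwined P Q) : IsOneCentral K Q := by
  obtain ⟨e, he⟩ := h
  have hQ : ∀ s w, Q s w = e (P s (e.symm w)) := fun s w => by simp [he]
  refine ⟨?_, fun x y => ?_, fun z hz => ?_⟩
  · ext w; simp [hQ, hP.map_one]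
  · ext w
    have := LinearMap.congr_fun (hP.map_mul x y) (e.symm w)
    simp only [Module.End.mul_apply] at this ⊢
    simp [hQ, this]
  · ext w; simp [hQ, hP.central z hz]

theorem prod (hP : IsOneCentral K P) (hQ : IsOneCentral K Q) :
    IsOneCentral K (fun s => (P s).prodMap (Q s)) := by
  refine ⟨?_, fun x y => ?_, fun z hz => ?_⟩
  · simp only [hP.map_one, hQ.map_one]; rfl
  · refine LinearMap.ext fun v => ?_
    exact Prod.ext (LinearMap.congr_fun (hP.map_mul x y) v.1)
      (LinearMap.congr_fun (hQ.map_mul x y) v.2)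
  · simp only [hP.central, hQ.central]; rfl

theorem zero (K : Subgroup (CentralExt α hα)) : IsOneCentral K (OpFamily.zero K).op := by
  have : Subsingleton (Fin (OpFamily.zero K).dim → ℂ) := inferInstanceAs (Subsingleton (Fin 0 → ℂ))
  exact ⟨Subsingleton.elim _ _, fun _ _ => Subsingleton.elim _ _, fun _ _ => Subsingleton.elim _ _⟩

theorem pull {P : L → Module.End ℂ V} (hP : IsOneCentral L P) (g : CentralExt α hα)
    (hg : ∀ h ∈ K, g⁻¹ * h * g ∈ L) :
    IsOneCentral K (fun h => (1 : ℂ) • P (conjMap g hg h)) := by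
  refine ⟨?_, fun x y => ?_, fun z hz => ?_⟩
  · have : conjMap g hg 1 = 1 := Subtype.ext (by simp [conjMap])
    rw [this, hP.map_one, one_smul]
  · have h1 : conjMap g hg x * conjMap g hg y = conjMap g hg (x * y) :=
      Subtype.ext (by simp only [conjMap, Subgroup.coe_mul]; group)
    simp only [one_smul, hP.map_mul, h1]
  · have e : g⁻¹ * incl hα z * g = incl hα z := conj_of_base_eq_one _ _ rfl
    have hz' : incl hα z ∈ L := e ▸ hg _ hz
    have : conjMap g hg ⟨incl hα z, hz⟩ = ⟨incl hα z, hz'⟩ := Subtype.ext e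
    rw [one_smul, this, hP.central]

end IsOneCentral

/-- The monoid of isomorphism classes of finite-dimensional `1`-central representations of `K`. -/
def oneCentralReps (K : Subgroup (CentralExt α hα)) : AddSubmonoid (OpClass K) where
  carrier := {x | ∃ P : OpFamily K, IsOneCentral K P.op ∧ OpClass.mk P = x}
  zero_mem' := ⟨OpFamily.zero K, .zero K, rfl⟩
  add_mem' := by
    rintro _ _ ⟨P, hP, rfl⟩ ⟨Q, hQ, rfl⟩
    exact ⟨P.add Q, (hP.prod hQ).of_intertwined (P.add_intertwined Q).symm, rfl⟩

/-- The `1`-central representation group `R_1(K)`. -/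
abbrev OneCentralRepGroup (K : Subgroup (CentralExt α hα)) : Type u :=
  Algebra.GrothendieckAddGroup (oneCentralReps K)

variable {H K L : Subgroup (CentralExt α hα)}

/-- Restriction of representations along `h ↦ g⁻¹hg`, on isomorphism classes. -/
def oneCentralRes (g : CentralExt α hα) (hg : ∀ h ∈ H, g⁻¹ * h * g ∈ K) :
    oneCentralReps K →+ oneCentralReps H :=
  pullOn _ _ (conjMap g hg) (fun _ => 1) <| by
    rintro _ ⟨P, hP, rfl⟩
    exact ⟨_, hP.pull g hg, rfl⟩

theorem oneCentralRes_comp (g f : CentralExt α hα) (hg : ∀ h ∈ H, g⁻¹ * h * g ∈ K)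
    (hf : ∀ h ∈ K, f⁻¹ * h * f ∈ L) (hgf : ∀ h ∈ H, (g * f)⁻¹ * h * (g * f) ∈ L) :
    (oneCentralRes g hg).comp (oneCentralRes f hf) = oneCentralRes (g * f) hgf := by
  ext x
  refine (OpClass.pull_pull _ _ _ _ _).trans ?_
  have h1 : conjMap f hf ∘ conjMap g hg = conjMap (g * f) hgf :=
    funext fun h => Subtype.ext (by simp only [conjMap, Function.comp]; group)
  rw [h1, one_mul]; rfl

theorem oneCentralRes_eq_id (g : CentralExt α hα) (hg1 : g ∈ H) (hg : ∀ h ∈ H, g⁻¹ * h * g ∈ H)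
    (x : oneCentralReps H) : oneCentralRes g hg x = x := by
  obtain ⟨_, P, hP, rfl⟩ := x
  refine Subtype.ext (OpClass.mk_eq_mk.2 ?_)
  obtain ⟨u, hu⟩ := hP.isUnit ⟨g, hg1⟩
  refine ⟨LinearMap.GeneralLinearGroup.generalLinearEquiv ℂ _ u, fun h v => ?_⟩
  have key : P.op ⟨g, hg1⟩ * ((1 : ℂ) • P.op (conjMap g hg h)) =
      P.op h * P.op ⟨g, hg1⟩ := by
    have e : (⟨g, hg1⟩ : H) * conjMap g hg h = h * ⟨g, hg1⟩ :=
      Subtype.ext (by simp only [conjMap, Subgroup.coe_mul]; group)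
    rw [one_smul, hP.map_mul, hP.map_mul, e]
  rw [← hu] at key
  exact LinearMap.congr_fun key v

/-- On isomorphism classes the restriction along `h ↦ g⁻¹hg` depends only on the coset `gK`. -/
theorem oneCentralRes_congr (g g' : CentralExt α hα) (hg : ∀ h ∈ H, g⁻¹ * h * g ∈ K)
    (hg' : ∀ h ∈ H, g'⁻¹ * h * g' ∈ K) (h : g⁻¹ * g' ∈ K) :
    oneCentralRes g hg = oneCentralRes g' hg' := by
  have hk : ∀ x ∈ K, (g⁻¹ * g')⁻¹ * x * (g⁻¹ * g') ∈ K := fun x hx =>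
    K.mul_mem (K.mul_mem (K.inv_mem h) hx) h
  have e := oneCentralRes_comp g (g⁻¹ * g') hg hk (by simpa using hg')
  have : g * (g⁻¹ * g') = g' := by group
  simp only [this] at e
  rw [← e]
  ext x
  simp only [AddMonoidHom.comp_apply]
  rw [oneCentralRes_eq_id _ h]

/-! ### From twisted to `1`-central representations -/

/-- The projection `K → ρ(K)`. -/
def toImage (K : Subgroup (CentralExt α hα)) (x : K) : K.map (proj hα) :=
  ⟨proj hα x, Subgroup.mem_map_of_mem _ x.2⟩

theorem isOneCentral_untwist {K : Subgroup (CentralExt α hα)} {V : Type} [AddCommGroup V]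
    [Module ℂ V] {P : K.map (proj hα) → Module.End ℂ V} (hP : α.IsTwisted (K.map (proj hα)) P) :
    IsOneCentral K (fun x => (((x : CentralExt α hα).fiber : Circle) : ℂ) • P (toImage K x)) := by
  refine ⟨?_, fun x y => ?_, fun z hz => ?_⟩
  · have : toImage K 1 = 1 := rfl
    rw [this, hP.map_one, Subgroup.coe_one, fiber_one, Circle.coe_one, one_smul]
  · have : toImage K (x * y) = toImage K x * toImage K y := rfl
    rw [smul_mul_smul_comm, hP.map_mul, smul_smul, this, Subgroup.coe_mul, fiber_mul,
      Circle.coe_mul, Circle.coe_mul, mul_comm]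
    rfl
  · have : toImage K ⟨incl hα z, hz⟩ = 1 := rfl
    rw [this, hP.map_one]
    rfl

/-- On isomorphism classes, the map sending an `α`-twisted representation `P` of `ρ(K)` to the
`1`-central representation `(h, t) ↦ t • P(h)` of `K`. -/
def untwist (K : Subgroup (CentralExt α hα)) :
    α.twistedReps (K.map (proj hα)) →+ oneCentralReps K :=
  pullOn _ _ (toImage K) (fun x => (((x : CentralExt α hα).fiber : Circle) : ℂ)) <| by
    rintro _ ⟨P, hP, rfl⟩
    exact ⟨_, isOneCentral_untwist hP, rfl⟩

theorem untwist_res (g : CentralExt α hα) (hg : ∀ h ∈ H, g⁻¹ * h * g ∈ K)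
    (hg' : ∀ h ∈ H.map (proj hα), (proj hα g)⁻¹ * h * proj hα g ∈ K.map (proj hα)) :
    (untwist H).comp (α.twistedRes (proj hα g) hg') = (oneCentralRes g hg).comp (untwist K) := by
  ext x
  refine (OpClass.pull_pull _ _ _ _ _).trans (Eq.trans ?_ (OpClass.pull_pull _ _ _ _ _).symm)
  congr 2
  funext h
  rw [one_mul, ← Circle.coe_mul]
  congr 1
  have key : ((g * (g⁻¹ * h * g)).fiber : Circle) = ((h : CentralExt α hα) * g).fiber := by
    congr 2; group
  rw [fiber_mul g, fiber_mul (h : CentralExt α hα) g] at key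
  have e : (g⁻¹ * (h : CentralExt α hα) * g).base = g.base⁻¹ * (h : CentralExt α hα).base * g.base := rfl
  rw [e] at key
  change ((h : CentralExt α hα).fiber : Circle) *
    (α (h : CentralExt α hα).base g.base / α g.base (g.base⁻¹ * (h : CentralExt α hα).base * g.base)) =
      ((g⁻¹ * (h : CentralExt α hα) * g).fiber : Circle)
  rw [mul_div_assoc', div_eq_iff_eq_mul]
  apply mul_right_cancel (b := (g.fiber : Circle))
  calc _ = α (h : CentralExt α hα).base g.base * ((h : CentralExt α hα).fiber * g.fiber : Circle) := by
        ac_rfl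
    _ = _ := by rw [← key]; ac_rfl

end CentralExt

/-! ### The orbit category of finite subgroups -/

/-- The orbit category `Or_FIN(G)`: an object is a finite subgroup `H`, standing for the orbit
`G/H`; a morphism is a `G`-equivariant map of orbits. -/
structure FinOrb (G : Type u) [Group G] where
  sub : Subgroup G
  fin : Finite sub

namespace FinOrb

variable {G : Type u} [Group G]

instance : Category.{u} (FinOrb G) where
  Hom H K := (G ⧸ H.sub) →[G] (G ⧸ K.sub)
  id H := MulActionHom.id G
  comp f g := MulActionHom.comp g f

/-- The equivariant map underlying a morphism. -/
def toMap {H K : FinOrb G} (φ : H ⟶ K) : (G ⧸ H.sub) →[G] (G ⧸ K.sub) := φ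

/-- `φ : G/H → G/K` is given by `xH ↦ xgK`. -/
def Rep {H K : FinOrb G} (φ : H ⟶ K) (g : G) : Prop :=
  toMap φ ((1 : G) : G ⧸ H.sub) = (g : G ⧸ K.sub)

theorem Rep.apply {H K : FinOrb G} {φ : H ⟶ K} {g : G} (h : Rep φ g) (x : G) :
    toMap φ (x : G ⧸ H.sub) = ((x * g : G) : G ⧸ K.sub) := by
  have : (x : G ⧸ H.sub) = x • ((1 : G) : G ⧸ H.sub) := by
    rw [MulAction.Quotient.smul_coe, smul_eq_mul, mul_one]
  rw [this, map_smul, h, MulAction.Quotient.smul_coe, smul_eq_mul]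

/-- A chosen representative of `φ`. -/
def rep {H K : FinOrb G} (φ : H ⟶ K) : G := (toMap φ ((1 : G) : G ⧸ H.sub)).out

theorem rep_spec {H K : FinOrb G} (φ : H ⟶ K) : Rep φ (rep φ) := (QuotientGroup.out_eq' _).symm

theorem Rep.conj_mem {H K : FinOrb G} {φ : H ⟶ K} {g : G} (hg : Rep φ g) :
    ∀ h ∈ H.sub, g⁻¹ * h * g ∈ K.sub := fun h hh => by
  have h1 := hg.apply h
  have h2 : (h : G ⧸ H.sub) = ((1 : G) : G ⧸ H.sub) := QuotientGroup.eq.2 (by simpa using hh)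
  rw [h2, hg] at h1
  have := QuotientGroup.eq.1 h1
  rwa [← mul_assoc] at this

theorem Rep.inv_mul_mem {H K : FinOrb G} {φ : H ⟶ K} {g g' : G} (hg : Rep φ g) (hg' : Rep φ g') :
    g⁻¹ * g' ∈ K.sub := QuotientGroup.eq.1 (hg.symm.trans hg')

theorem Rep.id (H : FinOrb G) : Rep (𝟙 H) 1 := rfl

theorem Rep.comp {H K L : FinOrb G} {φ : H ⟶ K} {ψ : K ⟶ L} {g f : G} (hg : Rep φ g)
    (hf : Rep ψ f) : Rep (φ ≫ ψ) (g * f) := by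
  change toMap ψ (toMap φ _) = _
  rw [hg, hf.apply]

theorem hom_ext {H K : FinOrb G} {φ ψ : H ⟶ K} {g : G} (hφ : Rep φ g) (hψ : Rep ψ g) : φ = ψ := by
  have : toMap φ = toMap ψ := by
    ext x
    induction x using QuotientGroup.induction_on with
    | H x => rw [hφ.apply, hψ.apply]
  exact this

/-- The morphism `xH ↦ xgK`. -/
def ofElem {H K : FinOrb G} (g : G) (hg : ∀ h ∈ H.sub, g⁻¹ * h * g ∈ K.sub) : H ⟶ K :=
  show (G ⧸ H.sub) →[G] (G ⧸ K.sub) from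
  { toFun := Quotient.map' (· * g) fun a b h => by
      rw [QuotientGroup.leftRel_apply] at h ⊢
      have := hg _ h
      rwa [show (a * g)⁻¹ * (b * g) = g⁻¹ * (a⁻¹ * b) * g by group]
    map_smul' := fun a x => by
      induction x using QuotientGroup.induction_on with
      | H x => exact congrArg (fun y : G => (y : G ⧸ K.sub)) (mul_assoc a x g) }

theorem rep_ofElem {H K : FinOrb G} (g : G) (hg : ∀ h ∈ H.sub, g⁻¹ * h * g ∈ K.sub) :
    Rep (ofElem (H := H) (K := K) g hg) g :=
  congrArg (fun y : G => (y : G ⧸ K.sub)) (one_mul g)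

variable {G' : Type u} [Group G']

theorem map_conj_mem (f : G' →* G) {K L : FinOrb G'} (φ : K ⟶ L) :
    ∀ h ∈ K.sub.map f, (f (rep φ))⁻¹ * h * f (rep φ) ∈ L.sub.map f := by
  rintro _ ⟨k, hk, rfl⟩
  exact ⟨_, (rep_spec φ).conj_mem k hk, by simp⟩

/-- The functor `Or_FIN(G') → Or_FIN(G)`, `G'/K ↦ G/f(K)`, induced by a homomorphism `f`. -/
def mapFunctor (f : G' →* G) : FinOrb G' ⥤ FinOrb G where
  obj K := ⟨K.sub.map f, by
    have := K.fin
    exact Finite.of_surjective (f.subgroupMap K.sub) (f.subgroupMap_surjective K.sub)⟩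
  map φ := ofElem (f (rep φ)) (map_conj_mem f φ)
  map_id K := by
    refine hom_ext (rep_ofElem _ _) ?_
    have h := (Rep.id K).inv_mul_mem (rep_spec (𝟙 K))
    rw [inv_one, one_mul] at h
    refine (Rep.id _).trans (QuotientGroup.eq.2 ?_)
    rw [inv_one, one_mul]
    exact ⟨_, h, rfl⟩
  map_comp {K L M} φ ψ := by
    refine hom_ext (rep_ofElem _ _) ?_
    refine (Rep.comp (rep_ofElem _ _) (rep_ofElem _ _)).trans (QuotientGroup.eq.2 ?_)
    have h := ((rep_spec φ).comp (rep_spec ψ)).inv_mul_mem (rep_spec (φ ≫ ψ))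
    exact ⟨_, h, by simp⟩

theorem rep_mapFunctor (f : G' →* G) {K L : FinOrb G'} (φ : K ⟶ L) :
    Rep ((mapFunctor f).map φ) (f (rep φ)) :=
  rep_ofElem _ (map_conj_mem f φ)

/-- `f(g)` represents the image of the morphism represented by `g`. -/
theorem Rep.mapFunctor (f : G' →* G) {K L : FinOrb G'} {φ : K ⟶ L} {g : G'} (hg : Rep φ g) :
    Rep ((FinOrb.mapFunctor f).map φ) (f g) := by
  have h : Rep ((FinOrb.mapFunctor f).map φ) (f (rep φ)) := rep_mapFunctor f φ
  refine Eq.trans h (QuotientGroup.eq.2 ?_)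
  exact ⟨_, (rep_spec φ).inv_mul_mem hg, by simp⟩

end FinOrb

/-! ### Coefficient systems -/

/-- Contravariant coefficient systems on `Or_FIN(G)`. -/
abbrev CoeffSystem (G : Type u) [Group G] := (FinOrb G)ᵒᵖ ⥤ ModuleCat.{u} ℤ

/-- The coefficient system `G/H ↦ R_α(H)` of `α`-twisted representations; `G/H → G/K`,
`xH ↦ xgK`, acts by restriction along `H → K`, `h ↦ g⁻¹hg`. -/
def twistedCoeff {G : Type u} [Group G] (α : Cocycle G) : CoeffSystem G where
  obj H := ModuleCat.of ℤ (α.TwistedRepGroup H.unop.sub)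
  map φ := ModuleCat.ofHom
    (grMap (α.twistedRes (FinOrb.rep φ.unop) (FinOrb.rep_spec φ.unop).conj_mem)).toIntLinearMap
  map_id H := by
    have h := (FinOrb.Rep.id H.unop).inv_mul_mem (FinOrb.rep_spec (𝟙 H.unop))
    rw [inv_one, one_mul] at h
    have := grMap_id (α.twistedRes_eq_id _ h (FinOrb.rep_spec (𝟙 H.unop)).conj_mem)
    exact congrArg (fun f => ModuleCat.ofHom (AddMonoidHom.toIntLinearMap f)) this
  map_comp {H K L} φ ψ := by
    have h := (FinOrb.rep_spec ψ.unop).comp (FinOrb.rep_spec φ.unop)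
    have e := (grMap_comp _ _).trans (congrArg grMap ((α.twistedRes_comp _ _
      (FinOrb.rep_spec ψ.unop).conj_mem (FinOrb.rep_spec φ.unop).conj_mem h.conj_mem).trans
      (α.twistedRes_congr _ _ h.conj_mem (FinOrb.rep_spec (ψ.unop ≫ φ.unop)).conj_mem
        (h.inv_mul_mem (FinOrb.rep_spec _)))))
    exact (congrArg (fun f => ModuleCat.ofHom (AddMonoidHom.toIntLinearMap f)) e).symm

section OneCentral

variable {G : Type u} [Group G] {α : Cocycle G} {n : ℕ}

/-- The coefficient system `G_α/K ↦ R_1(K)` of `1`-central representations. -/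
def oneCentralCoeff (hα : α.ValuesIn n) : CoeffSystem (CentralExt α hα) where
  obj H := ModuleCat.of ℤ (CentralExt.OneCentralRepGroup H.unop.sub)
  map φ := ModuleCat.ofHom (grMap (CentralExt.oneCentralRes (FinOrb.rep φ.unop)
    (FinOrb.rep_spec φ.unop).conj_mem)).toIntLinearMap
  map_id H := by
    have h := (FinOrb.Rep.id H.unop).inv_mul_mem (FinOrb.rep_spec (𝟙 H.unop))
    rw [inv_one, one_mul] at h
    have := grMap_id
      (CentralExt.oneCentralRes_eq_id _ h (FinOrb.rep_spec (𝟙 H.unop)).conj_mem)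
    exact congrArg (fun f => ModuleCat.ofHom (AddMonoidHom.toIntLinearMap f)) this
  map_comp {H K L} φ ψ := by
    have h := (FinOrb.rep_spec ψ.unop).comp (FinOrb.rep_spec φ.unop)
    have e := (grMap_comp _ _).trans (congrArg grMap ((CentralExt.oneCentralRes_comp _ _
      (FinOrb.rep_spec ψ.unop).conj_mem (FinOrb.rep_spec φ.unop).conj_mem h.conj_mem).trans
      (CentralExt.oneCentralRes_congr _ _ h.conj_mem (FinOrb.rep_spec (ψ.unop ≫ φ.unop)).conj_mem
        (h.inv_mul_mem (FinOrb.rep_spec _)))))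
    exact (congrArg (fun f => ModuleCat.ofHom (AddMonoidHom.toIntLinearMap f)) e).symm

/-- The natural map `R_α(ρ(K)) → R_1(K)`, `P ↦ ((h, t) ↦ t • P(h))`. -/
def untwistCoeff (hα : α.ValuesIn n) :
    (FinOrb.mapFunctor (CentralExt.proj hα)).op ⋙ twistedCoeff α ⟶ oneCentralCoeff hα where
  app K := ModuleCat.ofHom (grMap (CentralExt.untwist K.unop.sub)).toIntLinearMap
  naturality {K L} φ := by
    have hr := FinOrb.rep_spec φ.unop
    have hr' := hr.mapFunctor (CentralExt.proj hα)
    have e := (grMap_comp _ _).trans ((congrArg grMap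
      (CentralExt.untwist_res _ hr.conj_mem hr'.conj_mem)).trans (grMap_comp _ _).symm)
    have e' := congrArg (fun t => (grMap (CentralExt.untwist L.unop.sub)).comp (grMap t))
      (α.twistedRes_congr _ _ (FinOrb.rep_spec _).conj_mem hr'.conj_mem
        ((FinOrb.rep_spec _).inv_mul_mem hr'))
    exact congrArg (fun f => ModuleCat.ofHom (AddMonoidHom.toIntLinearMap f)) (e'.trans e)

end OneCentral

/-! ### Proper `G`-CW-complexes and models for the classifying space for proper actions -/

/-- A `G`-CW-complex for a discrete group `G`: a CW-complex with a `G`-action permuting the cells,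
such that if a cell is sent to itself, this is done by the identity map. -/
structure GCWComplex (G : Type u) [Group G] where
  carrier : Type u
  [top : TopologicalSpace carrier]
  [t2 : T2Space carrier]
  [cw : Topology.CWComplex (Set.univ : Set carrier)]
  [action : MulAction G carrier]
  [continuous_smul : ContinuousConstSMul G carrier]
  permutes : ∀ (g : G) (n : ℕ) (e : Topology.RelCWComplex.cell (Set.univ : Set carrier) n),
    ∃ e' : Topology.RelCWComplex.cell (Set.univ : Set carrier) n,
      (g • ·) '' Topology.RelCWComplex.openCell n e = Topology.RelCWComplex.openCell n e'
  fixes : ∀ (g : G) (n : ℕ) (e : Topology.RelCWComplex.cell (Set.univ : Set carrier) n),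
    (g • ·) '' Topology.RelCWComplex.openCell n e = Topology.RelCWComplex.openCell n e →
      ∀ x ∈ Topology.RelCWComplex.openCell n e, g • x = x

namespace GCWComplex

open Topology

variable {G : Type u} [Group G]

instance : CoeSort (GCWComplex G) (Type u) := ⟨carrier⟩

attribute [instance] top t2 cw action continuous_smul

/-- The `n`-cells. -/
abbrev Cell (X : GCWComplex G) (n : ℕ) : Type u := RelCWComplex.cell (Set.univ : Set X) n

/-- The open cell with a given index. -/
abbrev openCell (X : GCWComplex G) {n : ℕ} (e : X.Cell n) : Set X :=
  RelCWComplex.openCell (C := (Set.univ : Set X)) n e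

/-- The action is proper: all cell stabilizers are finite. -/
def IsProper (X : GCWComplex G) : Prop :=
  ∀ (n : ℕ) (e : X.Cell n), {g : G | (g • ·) '' X.openCell e = X.openCell e}.Finite

/-- `X` with the action of `G'` through a homomorphism `f : G' → G`. -/
def res {G' : Type u} [Group G'] (f : G' →* G) (X : GCWComplex G) : GCWComplex G' :=
  letI : MulAction G' X := MulAction.compHom X f
  { carrier := X
    continuous_smul := ⟨fun g => continuous_const_smul (f g)⟩
    permutes := fun g n e => X.permutes (f g) n e
    fixes := fun g n e => X.fixes (f g) n e }

/-- A `G`-map. -/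
structure Map (Y X : GCWComplex G) where
  toFun : C(Y, X)
  map_smul : ∀ (g : G) (y : Y), toFun (g • y) = g • toFun y

/-- `G`-homotopy of `G`-maps. -/
def Map.Homotopic {Y X : GCWComplex G} (f₀ f₁ : Map Y X) : Prop :=
  ∃ F : f₀.toFun.Homotopy f₁.toFun, ∀ (g : G) (t : unitInterval) (y : Y),
    F (t, g • y) = g • F (t, y)

/-- `X` is a model for the classifying space for proper actions: `X` is a proper
`G`-CW-complex, and every proper `G`-CW-complex has a `G`-map to `X`, unique up to
`G`-homotopy. -/
def IsModel (X : GCWComplex G) : Prop :=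
  X.IsProper ∧ ∀ Y : GCWComplex G, Y.IsProper →
    ∃ f : Map Y X, ∀ f' : Map Y X, f'.Homotopic f

/-- The subset `X^H` of `H`-fixed points. -/
def fixed (X : GCWComplex G) (H : Subgroup G) : Set X := {x | ∀ h ∈ H, h • x = x}

/-- The union of the cells of dimension less than `n`, that is, the `(n-1)`-skeleton. -/
def skel (X : GCWComplex G) (n : ℕ) : Set X := ⋃ (m : ℕ) (_ : m < n) (e : X.Cell m), X.openCell e

theorem smul_mem_skel (X : GCWComplex G) (g : G) (n : ℕ) {x : X} (hx : x ∈ X.skel n) :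
    g • x ∈ X.skel n := by
  simp only [skel, Set.mem_iUnion] at hx ⊢
  obtain ⟨m, hm, e, hx⟩ := hx
  obtain ⟨e', he'⟩ := X.permutes g m e
  exact ⟨m, hm, e', he'.subset (Set.mem_image_of_mem _ hx)⟩

end GCWComplex

/-! ### Subquotients of modules -/

section SubQuot

variable {R : Type v} [Ring R] {M N L : ModuleCat.{u} R} {Z B : Submodule R M}
  {Z' B' : Submodule R N} {Z'' B'' : Submodule R L}

/-- The subquotient `Z / (B ∩ Z)` of a module. -/
def subQuot (Z B : Submodule R M) : ModuleCat.{u} R := ModuleCat.of R (Z ⧸ B.comap Z.subtype)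

/-- The map of subquotients induced by a homomorphism. -/
def subQuotMap (f : M ⟶ N) (hZ : ∀ z ∈ Z, f.hom z ∈ Z') (hB : ∀ b ∈ B, f.hom b ∈ B') :
    subQuot Z B ⟶ subQuot Z' B' :=
  ModuleCat.ofHom (Submodule.mapQ _ _ (f.hom.restrict hZ) fun z hz => hB z hz)

theorem subQuotMap_id {f : M ⟶ M} (hf : f = 𝟙 M) (hZ : ∀ z ∈ Z, f.hom z ∈ Z)
    (hB : ∀ b ∈ B, f.hom b ∈ B) : subQuotMap f hZ hB = 𝟙 (subQuot Z B) := by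
  subst hf
  ext x
  obtain ⟨z, rfl⟩ := Submodule.mkQ_surjective _ x
  rfl

theorem subQuotMap_comp {f : M ⟶ N} {g : N ⟶ L} {h : M ⟶ L} (e : f ≫ g = h)
    (hZ : ∀ z ∈ Z, f.hom z ∈ Z') (hB : ∀ b ∈ B, f.hom b ∈ B')
    (hZ' : ∀ z ∈ Z', g.hom z ∈ Z'') (hB' : ∀ b ∈ B', g.hom b ∈ B'')
    (hZ'' : ∀ z ∈ Z, h.hom z ∈ Z'') (hB'' : ∀ b ∈ B, h.hom b ∈ B'') :
    subQuotMap f hZ hB ≫ subQuotMap g hZ' hB' = subQuotMap h hZ'' hB'' := by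
  subst e
  ext x
  obtain ⟨z, rfl⟩ := Submodule.mkQ_surjective _ x
  rfl

theorem subQuotMap_zero (hZ : ∀ z ∈ Z, (0 : M ⟶ N).hom z ∈ Z')
    (hB : ∀ b ∈ B, (0 : M ⟶ N).hom b ∈ B') : subQuotMap (0 : M ⟶ N) hZ hB = 0 := by
  ext x
  obtain ⟨z, rfl⟩ := Submodule.mkQ_surjective _ x
  exact congrArg (Submodule.mkQ _) (Subtype.ext rfl)

end SubQuot

/-! ### Cellular chains -/

/-- A topological space with a sequence of subsets. -/
structure FiltSpace where
  space : Type u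
  [top : TopologicalSpace space]
  filt : ℕ → Set space

namespace FiltSpace

attribute [instance] top

/-- Filtration preserving continuous maps. -/
@[ext]
structure Hom (X Y : FiltSpace.{u}) where
  toFun : C(X.space, Y.space)
  mapsTo : ∀ n, Set.MapsTo toFun (X.filt n) (Y.filt n)

instance : Category.{u} FiltSpace.{u} where
  Hom := Hom
  id X := ⟨ContinuousMap.id _, fun n => Set.mapsTo_id _⟩
  comp f g := ⟨g.toFun.comp f.toFun, fun n => (g.mapsTo n).comp (f.mapsTo n)⟩

/-- The underlying space. -/
def forget : FiltSpace.{u} ⥤ TopCat.{u} where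
  obj X := TopCat.of X.space
  map f := TopCat.ofHom (Hom.toFun f)

/-- The singular chain complex of a topological space with integral coefficients. -/
abbrev singTop : TopCat.{u} ⥤ ChainComplex (ModuleCat.{u} ℤ) ℕ :=
  (AlgebraicTopology.singularChainComplexFunctor (ModuleCat.{u} ℤ)).obj
    (ModuleCat.of ℤ (ULift.{u} ℤ))

/-- The singular chain complex of the underlying space. -/
abbrev sing (X : FiltSpace.{u}) : ChainComplex (ModuleCat.{u} ℤ) ℕ := singTop.obj (forget.obj X)

/-- The map of singular chain complexes induced by a filtration preserving map. -/
abbrev singMap {X Y : FiltSpace.{u}} (f : X ⟶ Y) : X.sing ⟶ Y.sing := singTop.map (forget.map f)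

/-- The inclusion of the `n`-th filtration subspace. -/
def inclTop (X : FiltSpace.{u}) (n : ℕ) : TopCat.of (X.filt n) ⟶ forget.obj X :=
  TopCat.ofHom ⟨Subtype.val, continuous_subtype_val⟩

/-- The singular `k`-chains of `X` that lie in the `n`-th filtration subspace. -/
def chainsIn (X : FiltSpace.{u}) (n k : ℕ) : Submodule ℤ (X.sing.X k) :=
  LinearMap.range ((singTop.map (X.inclTop n)).f k).hom

theorem d_mem_chainsIn (X : FiltSpace.{u}) (n k l : ℕ) {c : X.sing.X k}
    (hc : c ∈ X.chainsIn n k) : (X.sing.d k l).hom c ∈ X.chainsIn n l := by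
  obtain ⟨b, rfl⟩ := hc
  refine ⟨((singTop.obj (TopCat.of (X.filt n))).d k l).hom b, ?_⟩
  exact (LinearMap.congr_fun (congrArg ModuleCat.Hom.hom
    ((singTop.map (X.inclTop n)).comm k l)) b).symm

theorem map_mem_chainsIn {X Y : FiltSpace.{u}} (f : X ⟶ Y) (n k : ℕ) {c : X.sing.X k}
    (hc : c ∈ X.chainsIn n k) : ((singMap f).f k).hom c ∈ Y.chainsIn n k := by
  obtain ⟨b, rfl⟩ := hc
  let r : TopCat.of (X.filt n) ⟶ TopCat.of (Y.filt n) :=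
    TopCat.ofHom ⟨(Hom.mapsTo f n).restrict, (Hom.toFun f).continuous.restrict _⟩
  have e : X.inclTop n ≫ forget.map f = r ≫ Y.inclTop n := rfl
  have e' := (singTop.map_comp _ _).symm.trans ((congrArg singTop.map e).trans
    (singTop.map_comp _ _))
  refine ⟨((singTop.map r).f k).hom b, ?_⟩
  exact (LinearMap.congr_fun (congrArg (fun t => ModuleCat.Hom.hom (HomologicalComplex.Hom.f t k))
    e') b).symm

/-- Relative `n`-cycles of the pair `(X_{n+1}, X_n)` of filtration subspaces: the `n`-chains in
`X_{n+1}` with boundary in `X_n`. -/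
def relCycles (X : FiltSpace.{u}) (n : ℕ) : Submodule ℤ (X.sing.X n) :=
  X.chainsIn (n + 1) n ⊓ ⨅ l : ℕ, (X.chainsIn n l).comap (X.sing.d n l).hom

/-- Relative `n`-boundaries of the pair `(X_{n+1}, X_n)` of filtration subspaces. -/
def relBoundaries (X : FiltSpace.{u}) (n : ℕ) : Submodule ℤ (X.sing.X n) :=
  X.chainsIn n n ⊔ (X.chainsIn (n + 1) (n + 1)).map (X.sing.d (n + 1) n).hom

theorem mem_relCycles {X : FiltSpace.{u}} {n : ℕ} {c : X.sing.X n} : c ∈ X.relCycles n ↔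
    c ∈ X.chainsIn (n + 1) n ∧ ∀ l, (X.sing.d n l).hom c ∈ X.chainsIn n l := by
  rw [relCycles, Submodule.mem_inf, Submodule.mem_iInf]
  rfl

/-- The singular homology group `H_n(X_{n+1}, X_n; ℤ)`. -/
def relHomology (X : FiltSpace.{u}) (n : ℕ) : ModuleCat.{u} ℤ :=
  subQuot (X.relCycles n) (X.relBoundaries n)

theorem map_mem_relCycles {X Y : FiltSpace.{u}} (f : X ⟶ Y) (n : ℕ) :
    ∀ c ∈ X.relCycles n, ((singMap f).f n).hom c ∈ Y.relCycles n := fun c hc => by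
  rw [mem_relCycles] at hc ⊢
  refine ⟨map_mem_chainsIn f _ _ hc.1, fun l => ?_⟩
  have e := LinearMap.congr_fun (congrArg ModuleCat.Hom.hom ((singMap f).comm n l)) c
  exact e ▸ map_mem_chainsIn f n l (hc.2 l)

theorem map_mem_relBoundaries {X Y : FiltSpace.{u}} (f : X ⟶ Y) (n : ℕ) :
    ∀ c ∈ X.relBoundaries n, ((singMap f).f n).hom c ∈ Y.relBoundaries n := fun c hc => by
  obtain ⟨a, ha, _, ⟨b, hb, rfl⟩, rfl⟩ := Submodule.mem_sup.1 hc
  refine Submodule.mem_sup.2 ⟨_, map_mem_chainsIn f _ _ ha, _,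
    ⟨_, map_mem_chainsIn f _ _ hb, rfl⟩, ?_⟩
  have e := LinearMap.congr_fun (congrArg ModuleCat.Hom.hom ((singMap f).comm (n + 1) n)) b
  exact (congrArg _ e).trans (map_add ((singMap f).f n).hom _ _).symm

theorem d_mem_relCycles (X : FiltSpace.{u}) (n : ℕ) :
    ∀ c ∈ X.relCycles (n + 1), (X.sing.d (n + 1) n).hom c ∈ X.relCycles n := fun c hc => by
  rw [mem_relCycles] at hc ⊢
  refine ⟨hc.2 n, fun l => ?_⟩
  have e := LinearMap.congr_fun (congrArg ModuleCat.Hom.hom (X.sing.d_comp_d (n + 1) n l)) c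
  exact (congrArg (· ∈ X.chainsIn n l) e).mpr (Submodule.zero_mem _)

theorem d_mem_relBoundaries (X : FiltSpace.{u}) (n : ℕ) :
    ∀ c ∈ X.relBoundaries (n + 1), (X.sing.d (n + 1) n).hom c ∈ X.relBoundaries n := fun c hc => by
  obtain ⟨a, ha, _, ⟨b, hb, rfl⟩, rfl⟩ := Submodule.mem_sup.1 hc
  refine Submodule.mem_sup_right ⟨a, ha, ?_⟩
  have e := LinearMap.congr_fun (congrArg ModuleCat.Hom.hom
    (X.sing.d_comp_d (n + 1 + 1) (n + 1) n)) b
  rw [map_add]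
  exact (add_zero _).symm.trans (congrArg _ e.symm)

/-- The functor sending a filtered space `X` to `H_n(X_{n+1}, X_n; ℤ)`. -/
def relHomologyFunctor (n : ℕ) : FiltSpace.{u} ⥤ ModuleCat.{u} ℤ where
  obj X := X.relHomology n
  map f := subQuotMap ((singMap f).f n) (map_mem_relCycles f n) (map_mem_relBoundaries f n)
  map_id X := subQuotMap_id
    (congrArg (fun t => HomologicalComplex.Hom.f t n) (singTop.map_id (forget.obj X))) _ _
  map_comp f g := (subQuotMap_comp (congrArg (fun t => HomologicalComplex.Hom.f t n)
    (singTop.map_comp (forget.map f) (forget.map g))).symm _ _ _ _ _ _).symm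

/-- The cellular boundary map `H_{n+1}(X_{n+2}, X_{n+1}) → H_n(X_{n+1}, X_n)`, induced by the
boundary of singular chains. -/
def cellularD (n : ℕ) : relHomologyFunctor.{u} (n + 1) ⟶ relHomologyFunctor.{u} n where
  app X := subQuotMap (X.sing.d (n + 1) n) (X.d_mem_relCycles n) (X.d_mem_relBoundaries n)
  naturality X Y f := (subQuotMap_comp ((singMap f).comm (n + 1) n)
      (map_mem_relCycles f (n + 1)) (map_mem_relBoundaries f (n + 1))
      (Y.d_mem_relCycles n) (Y.d_mem_relBoundaries n)
      (fun c hc => map_mem_relCycles f n _ (X.d_mem_relCycles n c hc))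
      (fun c hc => map_mem_relBoundaries f n _ (X.d_mem_relBoundaries n c hc))).trans
    (subQuotMap_comp rfl (X.d_mem_relCycles n) (X.d_mem_relBoundaries n)
      (map_mem_relCycles f n) (map_mem_relBoundaries f n) _ _).symm

theorem cellularD_comp (n : ℕ) : cellularD.{u} (n + 1) ≫ cellularD.{u} n = 0 := by
  ext X : 2
  change (cellularD (n + 1)).app X ≫ (cellularD n).app X = (0 : X.relHomology (n + 2) ⟶ _)
  exact (subQuotMap_comp (X.sing.d_comp_d (n + 1 + 1) (n + 1) n)
    (X.d_mem_relCycles (n + 1)) (X.d_mem_relBoundaries (n + 1))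
    (X.d_mem_relCycles n) (X.d_mem_relBoundaries n)
    (fun _ _ => Submodule.zero_mem _) (fun _ _ => Submodule.zero_mem _)).trans
    (subQuotMap_zero _ _)

/-- The cellular chain complex of a filtered space, as a functor: `H_n(X_{n+1}, X_n; ℤ)` in
degree `n`. -/
def cellularChains : ChainComplex (FiltSpace.{u} ⥤ ModuleCat.{u} ℤ) ℕ :=
  ChainComplex.of relHomologyFunctor cellularD cellularD_comp

end FiltSpace

/-! ### Bredon cohomology -/

section Cohomology

variable {G : Type u} [Group G]

/-- The functor `G/H ↦ X^H`, filtered by the sets `X^H ∩ skel n`; the morphism `G/H → G/K`,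
`xH ↦ xgK`, acts by `X^K → X^H`, `x ↦ gx`. -/
def fixedFunctor (X : GCWComplex G) : (FinOrb G)ᵒᵖ ⥤ FiltSpace.{u} where
  obj H := { space := X.fixed H.unop.sub, filt := fun n => Subtype.val ⁻¹' X.skel n }
  map {K H} φ := ⟨⟨fun x => ⟨FinOrb.rep φ.unop • (x : X), fun h hh => by
      have := x.2 _ ((FinOrb.rep_spec φ.unop).conj_mem h hh)
      rw [mul_smul, mul_smul, inv_smul_eq_iff] at this
      exact this⟩, (continuous_subtype_val.const_smul _).subtype_mk _⟩,
      fun n _ hx => X.smul_mem_skel _ n hx⟩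
  map_id H := by
    refine FiltSpace.Hom.ext (ContinuousMap.ext fun x => Subtype.ext ?_)
    have h := (FinOrb.Rep.id H.unop).inv_mul_mem (FinOrb.rep_spec (𝟙 H.unop))
    rw [inv_one, one_mul] at h
    exact x.2 _ h
  map_comp {L K H} ψ φ := by
    refine FiltSpace.Hom.ext (ContinuousMap.ext fun x => Subtype.ext ?_)
    have h := ((FinOrb.rep_spec φ.unop).comp (FinOrb.rep_spec ψ.unop)).inv_mul_mem
      (FinOrb.rep_spec (φ.unop ≫ ψ.unop))
    have := x.2 _ h
    rw [mul_smul, inv_smul_eq_iff, mul_smul] at this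
    exact this

/-- The Bredon chain complex `C_*(X) : Or_FIN(G)ᵒᵖ → Ch(ℤ)`, `G/H ↦ C_*(X^H)`, as a chain complex
of contravariant functors. -/
def bredonChains (X : GCWComplex G) : ChainComplex (CoeffSystem G) ℕ :=
  (((Functor.whiskeringLeft _ _ _).obj (fixedFunctor X)).mapHomologicalComplex _).obj
    FiltSpace.cellularChains

/-- The Bredon cochain complex: natural transformations `C_n(X) → M` in degree `n`. -/
def bredonCochains (X : GCWComplex G) (M : CoeffSystem G) : CochainComplex (ModuleCat.{u} ℤ) ℕ :=
  (bredonChains X).linearYonedaObj ℤ M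

/-- Bredon cohomology `H_G^n(X; M)`. -/
def bredonCohomology (X : GCWComplex G) (M : CoeffSystem G) (n : ℕ) : ModuleCat.{u} ℤ :=
  (bredonCochains X M).homology n

variable {G' : Type u} [Group G']

theorem mem_fixed_map (f : G' →* G) (X : GCWComplex G) (K : FinOrb G') {x : X}
    (hx : ∀ k ∈ K.sub, f k • x = x) : x ∈ X.fixed (K.sub.map f) := by
  rintro _ ⟨k, hk, rfl⟩
  exact hx k hk

/-- The identity `X^K → X^{f(K)}`, where `K ≤ G'` acts on `X` through `f : G' → G`. -/
def fixedResMap (f : G' →* G) (X : GCWComplex G) (K : FinOrb G') :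
    C((X.res f).fixed K.sub, X.fixed (K.sub.map f)) where
  toFun x := ⟨x.1, mem_fixed_map f X K x.2⟩
  continuous_toFun := continuous_subtype_val.subtype_mk _

theorem fixedRes_smul (f : G' →* G) (X : GCWComplex G) {K L : FinOrb G'} (φ : K ⟶ L) (x : X)
    (hx : ∀ k ∈ L.sub, f k • x = x) :
    f (FinOrb.rep φ) • x = FinOrb.rep ((FinOrb.mapFunctor f).map φ) • x := by
  obtain ⟨k, hk, e⟩ := (FinOrb.rep_mapFunctor f φ).inv_mul_mem
    (FinOrb.rep_spec ((FinOrb.mapFunctor f).map φ))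
  have := hx k hk
  rw [e, mul_smul, inv_smul_eq_iff] at this
  exact this.symm

/-- The identity maps `X^K → X^{f(K)}` are natural and respect skeleta. -/
def fixedRes (f : G' →* G) (X : GCWComplex G) :
    fixedFunctor (X.res f) ⟶ (FinOrb.mapFunctor f).op ⋙ fixedFunctor X where
  app K := ⟨fixedResMap f X K.unop, fun _ _ hx => hx⟩
  naturality {L K} φ := by
    refine FiltSpace.Hom.ext (ContinuousMap.ext fun x => Subtype.ext ?_)
    exact fixedRes_smul f X φ.unop x.1 x.2

/-- The induced chain map `C_*(X^K) → C_*(X^{f(K)})`, natural in `G'/K`. -/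
def bredonChainsRes (f : G' →* G) (X : GCWComplex G) :
    bredonChains (X.res f) ⟶
      (((Functor.whiskeringLeft _ _ (ModuleCat.{u} ℤ)).obj
        (FinOrb.mapFunctor f).op).mapHomologicalComplex _).obj (bredonChains X) where
  f n := Functor.whiskerRight (fixedRes f X) (FiltSpace.cellularChains.X n)
  comm' i j _ := by
    ext K : 2
    exact (FiltSpace.cellularChains.d i j).naturality ((fixedRes f X).app K)

/-- The homomorphism sending a natural transformation `c : C ⟶ M` to the composite
`C' ⟶ q ⋙ C ⟶ q ⋙ M ⟶ M'`. -/
def transport {R : Type} [CommRing R] {A B : Type u} [Category.{u} A] [Category.{u} B] (q : A ⥤ B)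
    {C M : B ⥤ ModuleCat.{u} R} {C' M' : A ⥤ ModuleCat.{u} R} (ν : C' ⟶ q ⋙ C)
    (T : q ⋙ M ⟶ M') : (C ⟶ M) →ₗ[R] (C' ⟶ M') where
  toFun c := ν ≫ Functor.whiskerLeft q c ≫ T
  map_add' c c' := by
    ext K x
    exact (map_add (T.app K).hom _ _ :)
  map_smul' m c := by
    ext K x
    exact (map_smul (T.app K).hom m _ :)

variable {α : Cocycle G} {n : ℕ}

/-- The map of Bredon cochain complexes `ρ^* : C_G^*(X; R_α) → C_{G_α}^*(X; R_1)`: a natural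
transformation `c` is sent to the composites
`C_*(X^K) → C_*(X^{ρ(K)}) → R_α(ρ(K)) → R_1(K)`, with `c` in the middle. -/
def rhoCochains (hα : α.ValuesIn n) (X : GCWComplex G) :
    bredonCochains X (twistedCoeff α) ⟶
      bredonCochains (X.res (CentralExt.proj hα)) (oneCentralCoeff hα) where
  f i := ModuleCat.ofHom (transport (FinOrb.mapFunctor (CentralExt.proj hα)).op
    ((bredonChainsRes (CentralExt.proj hα) X).f i) (untwistCoeff hα))
  comm' i j _ := by
    ext (c : (bredonChains X).X i ⟶ twistedCoeff α)
    have h := (bredonChainsRes (CentralExt.proj hα) X).comm j i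
    have h' := congrArg (· ≫ Functor.whiskerLeft (FinOrb.mapFunctor (CentralExt.proj hα)).op c ≫
      untwistCoeff hα) h.symm
    exact h'.trans (Category.assoc _ _ _)

/-- The map induced by `ρ` on Bredon cohomology. -/
def rhoCohomology (hα : α.ValuesIn n) (X : GCWComplex G) (i : ℕ) :
    bredonCohomology X (twistedCoeff α) i ⟶
      bredonCohomology (X.res (CentralExt.proj hα)) (oneCentralCoeff hα) i :=
  HomologicalComplex.homologyMap (rhoCochains hα X) i

end Cohomology

end Bredon

end

namespace Bredon

open Algebra

/-! The cohomological statement already holds on cochains, where `rhoCochains` is a composite of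
three isomorphisms. On coefficients, dividing a `1`-central representation of `K` by the fibre
coordinate `t` leaves an operator that depends only on the base, because elements of `K` over the
same base differ by a central `z` acting as the scalar `z`. The law `(g,s)(h,t) = (gh, α(g,h)st)`
turns multiplicativity into the `α`-twisted relation. So `untwist` is bijective on isomorphism
classes, and `untwistCoeff` is an isomorphism. On spaces, `K` acts through `ρ(K)`, so `X^K =
X^{ρ(K)}` and `fixedRes` is an isomorphism. On orbit categories, `K ↦ ρ(K)` has the right adjoint `H
↦ ρ⁻¹(H)`, which preserves finiteness because `ker ρ ≅ ℤ/n` is finite. Since `ρ(ρ⁻¹(H)) = H`, the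
counit is invertible, so `K ↦ ρ(K)` is a localization and restriction along it is bijective on
natural transformations (`whiskerLeft_mapFunctor_bijective`).

For the statement about models, let `Y` be a proper `G_α`-CW-complex. The finite kernel acts
trivially on `X`, so `G_α`-maps `Y → X` are the same as `G`-maps `Y/ker ρ → X`. The main labour is
to show that `Y/ker ρ` is again a proper `G`-CW-complex (`orbitCWComplex`, `kerQuotient`). The
universal property of `X` over `G` then gives the one over `G_α` (`IsModel.res`). -/

/-- An additive bijection of commutative monoids induces a bijection of Grothendieck groups. -/
theorem grMap_bijective {A : Type u} {B : Type v} [AddCommMonoid A] [AddCommMonoid B] {f : A →+ B}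
    (hf : Function.Bijective f) : Function.Bijective (grMap f) := by
  let e := AddEquiv.ofBijective f hf
  have h1 : (grMap e.symm.toAddMonoidHom).comp (grMap f) = AddMonoidHom.id _ :=
    (grMap_comp _ _).trans (grMap_id fun a => e.symm_apply_apply a)
  have h2 : (grMap f).comp (grMap e.symm.toAddMonoidHom) = AddMonoidHom.id _ :=
    (grMap_comp _ _).trans (grMap_id fun b => e.apply_symm_apply b)
  exact Function.bijective_iff_has_inverse.2
    ⟨grMap e.symm.toAddMonoidHom, DFunLike.congr_fun h1, DFunLike.congr_fun h2⟩

/-! ### Twisted representations of `ρ(K)` versus `1`-central representations of `K`. -/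

namespace CentralExt

variable {G : Type u} [Group G] {α : Cocycle G} {n : ℕ} {hα : α.ValuesIn n}
  {K : Subgroup (CentralExt α hα)}

theorem toImage_surjective (K : Subgroup (CentralExt α hα)) : Function.Surjective (toImage K) := by
  rintro ⟨_, x, hx, rfl⟩
  exact ⟨⟨x, hx⟩, rfl⟩

/-- A set-theoretic section of the projection `K → ρ(K)`. -/
noncomputable def imageLift (K : Subgroup (CentralExt α hα)) (h : K.map (proj hα)) : K :=
  Function.surjInv (toImage_surjective K) h

theorem toImage_imageLift (h : K.map (proj hα)) : toImage K (imageLift K h) = h :=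
  Function.surjInv_eq _ h

/-- Since `α(1, g) = 1`, multiplying by a central element changes only the fibre, and it does so
without a cocycle correction. -/
theorem incl_div_fiber_mul (x y : CentralExt α hα) (h : x.base = y.base) :
    incl hα (y.fiber / x.fiber) * x = y :=
  CentralExt.ext ((one_mul _).trans h) <| Subtype.ext <| by
    simp [fiber_mul, incl, α.one_left]

/-- A `1`-central representation, divided by the fibre coordinate, depends only on the base. -/
theorem IsOneCentral.inv_fiber_smul_congr {V : Type} [AddCommGroup V] [Module ℂ V]
    {Q : K → Module.End ℂ V} (hQ : IsOneCentral K Q) {x y : K}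
    (h : toImage K x = toImage K y) :
    (((x : CentralExt α hα).fiber : Circle) : ℂ)⁻¹ • Q x =
      (((y : CentralExt α hα).fiber : Circle) : ℂ)⁻¹ • Q y := by
  have e := incl_div_fiber_mul (x : CentralExt α hα) y (congrArg Subtype.val h)
  -- `K` need not contain all of `ℤ/n`, and `hQ.central` speaks only of central elements in `K`.
  -- This one is `y x⁻¹`, hence in `K`.
  have hz : incl hα ((y : CentralExt α hα).fiber / (x : CentralExt α hα).fiber) ∈ K := by
    rw [eq_mul_inv_of_mul_eq e]
    exact K.mul_mem y.2 (K.inv_mem x.2)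
  have hy : (⟨_, hz⟩ : K) * x = y := Subtype.ext e
  rw [← hy, ← hQ.map_mul, hQ.central, smul_mul_assoc, one_mul, smul_smul, hy]
  congr 1
  have := Circle.coe_ne_zero ((y : CentralExt α hα).fiber : Circle)
  simp
  field_simp

/-- The `α`-twisted representation `h ↦ t⁻¹ • Q(h, t)` of `ρ(K)` attached to a `1`-central
representation `Q` of `K`. -/
noncomputable def retwist {V : Type} [AddCommGroup V] [Module ℂ V] (Q : K → Module.End ℂ V)
    (h : K.map (proj hα)) : Module.End ℂ V :=
  (((imageLift K h : CentralExt α hα).fiber : Circle) : ℂ)⁻¹ • Q (imageLift K h)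

/-- Removes the arbitrary section `imageLift`: any lift of a base element computes `retwist`. -/
theorem IsOneCentral.retwist_toImage {V : Type} [AddCommGroup V] [Module ℂ V]
    {Q : K → Module.End ℂ V} (hQ : IsOneCentral K Q) (x : K) :
    retwist Q (toImage K x) = (((x : CentralExt α hα).fiber : Circle) : ℂ)⁻¹ • Q x :=
  hQ.inv_fiber_smul_congr (toImage_imageLift _)

/-- The fibre of `xy` is `α(x,y)` times the product of the fibres, so dividing by fibres inserts
exactly the factor `α(x,y)`. -/
theorem IsOneCentral.isTwisted_retwist {V : Type} [AddCommGroup V] [Module ℂ V]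
    {Q : K → Module.End ℂ V} (hQ : IsOneCentral K Q) :
    α.IsTwisted (K.map (proj hα)) (retwist Q) := by
  refine ⟨?_, fun x y => ?_⟩
  · refine (hQ.retwist_toImage 1).trans ?_
    rw [hQ.map_one, Subgroup.coe_one, fiber_one, Circle.coe_one, inv_one, one_smul]
  · obtain ⟨x, rfl⟩ := toImage_surjective K x
    obtain ⟨y, rfl⟩ := toImage_surjective K y
    have hxy : toImage K x * toImage K y = toImage K (x * y) := rfl
    rw [hxy, hQ.retwist_toImage, hQ.retwist_toImage, hQ.retwist_toImage, smul_mul_smul_comm,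
      hQ.map_mul, smul_smul]
    congr 1
    have h := Circle.coe_ne_zero (α (x : CentralExt α hα).base (y : CentralExt α hα).base)
    rw [Subgroup.coe_mul, fiber_mul, Circle.coe_mul, Circle.coe_mul, mul_inv, mul_inv]
    exact (mul_inv_cancel_left₀ h _).symm

/-- The same linear isomorphism intertwines the twisted representations: the nonzero scalar `t`
cancels, and every element of `ρ(K)` has a lift. -/
theorem untwist_injective (K : Subgroup (CentralExt α hα)) : Function.Injective (untwist K) := by
  rintro ⟨_, P, hP, rfl⟩ ⟨_, P', hP', rfl⟩ h
  obtain ⟨e, he⟩ := OpClass.mk_eq_mk.1 (congrArg Subtype.val h)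
  refine Subtype.ext (OpClass.mk_eq_mk.2 ⟨e, fun s v => ?_⟩)
  obtain ⟨x, rfl⟩ := toImage_surjective K s
  have := (map_smul e _ _).symm.trans (he x v)
  exact smul_right_injective _ (Circle.coe_ne_zero ((x : CentralExt α hα).fiber : Circle)) this

theorem untwist_surjective (K : Subgroup (CentralExt α hα)) : Function.Surjective (untwist K) := by
  rintro ⟨_, Q, hQ, rfl⟩
  refine ⟨⟨_, ⟨Q.dim, retwist Q.op⟩, hQ.isTwisted_retwist, rfl⟩,
    Subtype.ext (OpClass.mk_eq_mk.2 ⟨LinearEquiv.refl ℂ _, fun x v => ?_⟩)⟩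
  refine LinearMap.congr_fun (f := (((x : CentralExt α hα).fiber : Circle) : ℂ) •
    retwist Q.op (toImage K x)) ?_ v
  rw [hQ.retwist_toImage]
  exact smul_inv_smul₀ (Circle.coe_ne_zero _) _

end CentralExt

/-- Invertibility is checked orbit by orbit, on the monoids of isomorphism classes before they are
group-completed. -/
instance isIso_untwistCoeff {G : Type u} [Group G] {α : Cocycle G} {n : ℕ} (hα : α.ValuesIn n) :
    IsIso (untwistCoeff hα) := by
  have (K : (FinOrb (CentralExt α hα))ᵒᵖ) : IsIso ((untwistCoeff hα).app K) :=
    (ConcreteCategory.isIso_iff_bijective _).2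
      (grMap_bijective ⟨CentralExt.untwist_injective K.unop.sub,
        CentralExt.untwist_surjective K.unop.sub⟩)
  exact NatIso.isIso_of_isIso_app _

/-! ### Saturated finite subgroups of an extension with finite kernel -/

/-- Each nonempty fibre of `f` is a coset of the finite kernel. -/
theorem finite_preimage {G G' : Type u} [Group G] [Group G'] (f : G' →* G) [Finite f.ker]
    {s : Set G} (hs : s.Finite) : (f ⁻¹' s).Finite := by
  refine hs.preimage' fun b _ => ?_
  rcases (f ⁻¹' {b}).eq_empty_or_nonempty with h | ⟨x, hx⟩
  · simp [h]
  · refine ((Set.toFinite (f.ker : Set G')).image (x * ·)).subset fun y hy => ⟨x⁻¹ * y, ?_, by simp⟩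
    change f (x⁻¹ * y) = 1
    rw [map_mul, map_inv, hx.out, hy.out, inv_mul_cancel]

namespace FinOrb

variable {G G' : Type u} [Group G] [Group G']

theorem finite_comap (f : G' →* G) [Finite f.ker] (H : Subgroup G) [Finite H] :
    Finite (H.comap f) :=
  (finite_preimage f (Set.toFinite (H : Set G))).to_subtype

/-- The preimage of a finite subgroup under a homomorphism with finite kernel. -/
def comap (f : G' →* G) [Finite f.ker] (H : FinOrb G) : FinOrb G' :=
  ⟨H.sub.comap f, have := H.fin; finite_comap f H.sub⟩

variable (f : G' →* G) (hf : Function.Surjective f) [Finite f.ker]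

theorem surjInv_conj_mem {K : FinOrb G'} {H : FinOrb G} (φ : (mapFunctor f).obj K ⟶ H) :
    ∀ k ∈ K.sub, (Function.surjInv hf (rep φ))⁻¹ * k * Function.surjInv hf (rep φ) ∈
      (comap f H).sub := fun k hk => by
  change f _ ∈ H.sub
  rw [map_mul, map_mul, map_inv, Function.surjInv_eq hf]
  exact (rep_spec φ).conj_mem _ (Subgroup.mem_map_of_mem f hk)

theorem conj_mem_of_comap {K : FinOrb G'} {H : FinOrb G} (ψ : K ⟶ comap f H) :
    ∀ h ∈ ((mapFunctor f).obj K).sub, (f (rep ψ))⁻¹ * h * f (rep ψ) ∈ H.sub := by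
  rintro _ ⟨k, hk, rfl⟩
  have h : f _ ∈ H.sub := (rep_spec ψ).conj_mem k hk
  rwa [map_mul, map_mul, map_inv] at h

/-- `G`-maps `G/f(K) → G/H` correspond to `G'`-maps `G'/K → G'/f⁻¹(H)`. -/
noncomputable def homEquiv (K : FinOrb G') (H : FinOrb G) :
    ((mapFunctor f).obj K ⟶ H) ≃ (K ⟶ comap f H) where
  -- The choice of lift is immaterial: two lifts differ by an element of `ker f`, which lies in
  -- `f⁻¹(H)`, so they give the same coset.
  toFun φ := ofElem (Function.surjInv hf (rep φ)) (surjInv_conj_mem f hf φ)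
  invFun ψ := ofElem (f (rep ψ)) (conj_mem_of_comap f ψ)
  left_inv φ := by
    refine hom_ext (rep_ofElem _ _) ((rep_spec φ).trans (QuotientGroup.eq.2 ?_))
    have h : f _ ∈ H.sub := (rep_ofElem _ (surjInv_conj_mem f hf φ)).inv_mul_mem (rep_spec _)
    rwa [map_mul, map_inv, Function.surjInv_eq hf] at h
  right_inv ψ := by
    refine hom_ext (rep_ofElem _ _) ((rep_spec ψ).trans (QuotientGroup.eq.2 ?_))
    change f _ ∈ H.sub
    rw [map_mul, map_inv, Function.surjInv_eq hf]
    exact (rep_ofElem _ (conj_mem_of_comap f ψ)).inv_mul_mem (rep_spec _)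

/-- The inverse correspondence is `g ↦ f(g)` on arbitrary representatives, which makes compositions
computable. -/
theorem rep_homEquiv_symm {K : FinOrb G'} {H : FinOrb G} {ψ : K ⟶ comap f H} {g : G'}
    (h : Rep ψ g) : Rep ((homEquiv f hf K H).symm ψ) (f g) := by
  refine (rep_ofElem _ (conj_mem_of_comap f ψ)).trans (QuotientGroup.eq.2 ?_)
  rw [← map_inv, ← map_mul]
  exact (rep_spec ψ).inv_mul_mem h

theorem homEquiv_naturality (K K' : FinOrb G') (H : FinOrb G) (φ : K ⟶ K')
    (ψ : (mapFunctor f).obj K' ⟶ H) :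
    homEquiv f hf K H ((mapFunctor f).map φ ≫ ψ) = φ ≫ homEquiv f hf K' H ψ := by
  -- Naturality is checked for the inverse bijection: there representatives are transformed by the
  -- homomorphism `f`, whereas `Function.surjInv` need not be multiplicative.
  rw [← Equiv.eq_symm_apply]
  obtain ⟨ψ, rfl⟩ := (homEquiv f hf K' H).symm.surjective ψ
  rw [Equiv.apply_symm_apply]
  refine hom_ext (Rep.comp ((rep_spec φ).mapFunctor f) (rep_homEquiv_symm f hf (rep_spec ψ))) ?_
  rw [← map_mul]
  exact rep_homEquiv_symm f hf ((rep_spec φ).comp (rep_spec ψ))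

/-- The functor `G/H ↦ G'/f⁻¹(H)` is right adjoint to `G'/K ↦ G/f(K)`. -/
noncomputable def mapComapAdj :
    mapFunctor f ⊣ Adjunction.rightAdjointOfEquiv (homEquiv f hf) (homEquiv_naturality f hf) :=
  Adjunction.adjunctionOfEquivRight _ _

/-- By surjectivity `f(f⁻¹(H)) = H`; the counit is represented by `1`, and so is its inverse. -/
instance isIso_counit (H : FinOrb G) : IsIso ((mapComapAdj f hf).counit.app H) := by
  have hr : Rep ((mapComapAdj f hf).counit.app H) 1 := by
    have := rep_homEquiv_symm f hf (Rep.id (comap f H))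
    rw [map_one] at this
    simpa [mapComapAdj] using this
  let ψ : H ⟶ (mapFunctor f).obj (comap f H) := ofElem 1 fun h hh => by
    obtain ⟨g, rfl⟩ := hf h
    rw [inv_one, one_mul, mul_one]
    exact Subgroup.mem_map_of_mem f (show g ∈ H.sub.comap f from hh)
  have hψ : Rep ψ 1 := rep_ofElem _ _
  refine ⟨ψ, hom_ext (g := 1) ?_ (Rep.id _), hom_ext (g := 1) ?_ (Rep.id _)⟩
  · simpa using hr.comp hψ
  · simpa using hψ.comp hr

/-- Restriction of coefficient systems along `G'/K ↦ G/f(K)` is fully faithful. -/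
theorem whiskerLeft_mapFunctor_bijective (f : G' →* G) (hf : Function.Surjective f)
    [Finite f.ker] {E : Type*} [Category* E] (C M : (FinOrb G)ᵒᵖ ⥤ E) :
    Function.Bijective fun c : C ⟶ M => Functor.whiskerLeft (mapFunctor f).op c := by
  have : IsIso (mapComapAdj f hf).counit := NatIso.isIso_of_isIso_app _
  have h := (mapComapAdj f hf).fullyFaithfulROfIsIsoCounit
  have := h.full
  have := h.faithful
  -- An invertible counit makes the right adjoint fully faithful, so the left adjoint is a
  -- localization at the morphisms it inverts. Precomposition with a localization, here its
  -- opposite, is fully faithful on functors.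
  have : (mapFunctor f).IsLocalization ((MorphismProperty.isomorphisms _).inverseImage
    (mapFunctor f)) := (mapComapAdj f hf).isLocalization
  have := Localization.full_whiskeringLeft (mapFunctor f).op
    ((MorphismProperty.isomorphisms _).inverseImage (mapFunctor f)).op E
  have := Localization.faithful_whiskeringLeft (mapFunctor f).op
    ((MorphismProperty.isomorphisms _).inverseImage (mapFunctor f)).op E
  exact ((Functor.FullyFaithful.ofFullyFaithful
    ((Functor.whiskeringLeft _ _ E).obj (mapFunctor f).op)).map_bijective C M)

end FinOrb

/-! ### The cochain map -/

/-- Both fixed sets are the same subspace of `X` with the same filtration, so the identity also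
serves as inverse. -/
instance isIso_fixedRes {G G' : Type u} [Group G] [Group G'] (f : G' →* G) (X : GCWComplex G) :
    IsIso (fixedRes f X) := by
  have (K : (FinOrb G')ᵒᵖ) : IsIso ((fixedRes f X).app K) :=
    ⟨⟨⟨fun x => ⟨x.1, fun k hk => x.2 _ (Subgroup.mem_map_of_mem f hk)⟩,
      continuous_subtype_val.subtype_mk _⟩, fun _ _ hx => hx⟩, rfl, rfl⟩
  exact NatIso.isIso_of_isIso_app _

theorem transport_bijective {R : Type} [CommRing R] {A B : Type u} [Category.{u} A] [Category.{u} B]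
    (q : A ⥤ B) {C M : B ⥤ ModuleCat.{u} R} {C' M' : A ⥤ ModuleCat.{u} R} (ν : C' ⟶ q ⋙ C)
    (T : q ⋙ M ⟶ M') [IsIso ν] [IsIso T]
    (hq : Function.Bijective fun c : C ⟶ M => Functor.whiskerLeft q c) :
    Function.Bijective (transport q ν T) := by
  refine ⟨fun c c' h => hq.1 ?_, fun d => ?_⟩
  · exact (cancel_mono T).1 ((cancel_epi ν).1 h)
  · obtain ⟨c, hc⟩ := hq.2 (inv ν ≫ d ≫ inv T)
    refine ⟨c, ?_⟩
    change ν ≫ (fun c : C ⟶ M => Functor.whiskerLeft q c) c ≫ T = d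
    rw [hc]
    simp

/-- In each degree the map is a `transport` with invertible outer factors: cellular chains applied
to `fixedRes`, and `untwistCoeff`. The middle factor is bijective by
`whiskerLeft_mapFunctor_bijective`. -/
theorem isIso_rhoCochains {G : Type u} [Group G] {α : Cocycle G} {n : ℕ} (hα : α.ValuesIn n)
    [Finite (CentralExt.proj hα).ker] (X : GCWComplex G) : IsIso (rhoCochains hα X) := by
  have (i : ℕ) : IsIso ((rhoCochains hα X).f i) := by
    have : IsIso (Functor.whiskerRight (fixedRes (CentralExt.proj hα) X)
      (FiltSpace.cellularChains.X i)) := inferInstance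
    exact (ConcreteCategory.isIso_iff_bijective _).2 (@transport_bijective _ _ _ _ _ _ _ _ _ _ _
      ((bredonChainsRes (CentralExt.proj hα) X).f i) _ this _
      (FinOrb.whiskerLeft_mapFunctor_bijective _ (CentralExt.isCentralExtension hα).2.1 _ _))
  exact HomologicalComplex.Hom.isIso_of_components _

/-- The kernel is the image of the `n`-th roots of unity, which are finitely many because `n > 0`;
`Mu 0` would be the whole circle. -/
theorem CentralExt.finite_ker_proj {G : Type u} [Group G] {α : Cocycle G} {n : ℕ} (hn : 0 < n)
    (hα : α.ValuesIn n) : Finite (CentralExt.proj hα).ker := by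
  have : NeZero n := ⟨hn.ne'⟩
  have : Finite {z : ℂ | z ^ n = 1} :=
    ((Polynomial.nthRootsFinset n (1 : ℂ)).finite_toSet.subset fun z hz =>
      (Polynomial.mem_nthRootsFinset hn 1).2 hz)
  have : Finite (Mu n) := Finite.of_injective
    (fun z => (⟨((z : Circle) : ℂ), congrArg Circle.coeHom z.2⟩ : {z : ℂ | z ^ n = 1}))
    fun z w h => Subtype.ext (Circle.ext
      (congrArg (fun t : {z : ℂ | z ^ n = 1} => (t : ℂ)) h))
  rw [← (CentralExt.isCentralExtension hα).2.2.1]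
  exact Finite.of_surjective _ (CentralExt.incl hα).rangeRestrict_surjective

end Bredon

namespace Bredon

/-! ### Orbit spaces of finite group actions on CW-complexes -/

namespace GCWComplex

open Topology Metric

section OrbitSpace

variable {N : Type u} [Group N] (Z : GCWComplex N)

/-- The space of orbits. -/
abbrev OrbitSpace : Type u := Quotient (MulAction.orbitRel N Z)

/-- The projection to the space of orbits. -/
abbrev orbitMk (x : Z) : Z.OrbitSpace := Quotient.mk (MulAction.orbitRel N Z) x

variable {Z}

theorem orbitMk_eq_iff {x y : Z} : Z.orbitMk x = Z.orbitMk y ↔ ∃ g : N, g • x = y := by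
  rw [eq_comm]
  exact Quotient.eq.trans Iff.rfl

theorem isOpenQuotientMap_orbitMk : IsOpenQuotientMap Z.orbitMk :=
  MulAction.isOpenQuotientMap_quotientMk

/-- For an open quotient map, Hausdorffness means that the relation is closed. The orbit relation is
the union of the graphs of the group elements, finitely many closed sets. -/
instance [Finite N] : T2Space Z.OrbitSpace := by
  rw [t2Space_iff_of_isOpenQuotientMap isOpenQuotientMap_orbitMk]
  have : {q : Z × Z | Z.orbitMk q.1 = Z.orbitMk q.2} = ⋃ g : N, {q : Z × Z | g • q.1 = q.2} := by
    ext q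
    simp [orbitMk_eq_iff]
  rw [this]
  exact isClosed_iUnion_of_finite fun g =>
    isClosed_eq (continuous_fst.const_smul g) continuous_snd

theorem eq_of_mem_openCell {n m : ℕ} {e : Z.Cell n} {e' : Z.Cell m} {x : Z}
    (h : x ∈ Z.openCell e) (h' : x ∈ Z.openCell e') : (⟨n, e⟩ : Σ n, Z.Cell n) = ⟨m, e'⟩ :=
  RelCWComplex.eq_of_not_disjoint_openCell (Set.not_disjoint_iff.2 ⟨x, h, h'⟩)

/-- Open cells are disjoint and permuted, so an element moving one point of `e` into `e'` moves all
of `e` onto `e'`. The equality is in the sigma type because it includes `n = m`. -/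
theorem eq_of_orbitMk_eq {n m : ℕ} {e : Z.Cell n} {e' : Z.Cell m} {x y : Z}
    (h : x ∈ Z.openCell e) (h' : y ∈ Z.openCell e') (hxy : Z.orbitMk x = Z.orbitMk y) :
    ∃ (g : N) (e'' : Z.Cell n), g • x = y ∧ (g • ·) '' Z.openCell e = Z.openCell e'' ∧
      (⟨n, e''⟩ : Σ n, Z.Cell n) = ⟨m, e'⟩ := by
  obtain ⟨g, rfl⟩ := orbitMk_eq_iff.1 hxy
  obtain ⟨e'', he⟩ := Z.permutes g n e
  exact ⟨g, e'', rfl, he, eq_of_mem_openCell (he.subset (Set.mem_image_of_mem _ h)) h'⟩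

/-- Two equivalent points of one cell are related by an element that stabilizes the cell, hence
fixes it pointwise. Without that axiom the quotient could fold a cell. -/
theorem orbitMk_injOn_openCell {n : ℕ} (e : Z.Cell n) : Set.InjOn Z.orbitMk (Z.openCell e) := by
  intro x hx y hy hxy
  obtain ⟨g, e'', rfl, he, h⟩ := eq_of_orbitMk_eq hx hy hxy
  obtain rfl := sigma_mk_injective h
  exact (Z.fixes g n e'' he x hx).symm

theorem image_smul_closedCell {n : ℕ} {e e' : Z.Cell n} {g : N}
    (h : (g • ·) '' Z.openCell e = Z.openCell e') :
    (g • ·) '' RelCWComplex.closedCell (C := (Set.univ : Set Z)) n e =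
      RelCWComplex.closedCell n e' := by
  rw [← RelCWComplex.closure_openCell_eq_closedCell, ← RelCWComplex.closure_openCell_eq_closedCell,
    ← show (g • ·) '' RelCWComplex.openCell n e = RelCWComplex.openCell n e' from h]
  exact (Homeomorph.smul g).image_closure _

theorem orbitMk_image_image_smul (g : N) (s : Set Z) :
    Z.orbitMk '' ((g • ·) '' s) = Z.orbitMk '' s := by
  rw [Set.image_image]
  exact Set.image_congr fun x _ => (orbitMk_eq_iff.2 ⟨g, rfl⟩).symm

variable (Z) in
/-- Two cells are equivalent if they are exchanged by the action. -/
def cellSetoid (n : ℕ) : Setoid (Z.Cell n) where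
  r e e' := ∃ g : N, (g • ·) '' Z.openCell e = Z.openCell e'
  iseqv :=
    { refl := fun e => ⟨1, by simp⟩
      symm := by
        rintro e e' ⟨g, h⟩
        exact ⟨g⁻¹, by rw [← h, Set.image_image]; simp⟩
      trans := by
        rintro e e' e'' ⟨g, h⟩ ⟨g', h'⟩
        exact ⟨g' * g, by rw [← h', ← h, Set.image_image]; simp [mul_smul]⟩ }

variable (Z) in
/-- The cells of the space of orbits. -/
abbrev OrbitCell (n : ℕ) : Type u := Quotient (Z.cellSetoid n)

/-- Cells downstairs are described through a chosen representative; this lemma and the next two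
allow any cell of the class to replace it. -/
theorem exists_smul_out {n : ℕ} (e : Z.Cell n) : ∃ g : N, (g • ·) '' Z.openCell e =
    Z.openCell (Quotient.out (Quotient.mk (Z.cellSetoid n) e)) :=
  Quotient.exact (s := Z.cellSetoid n) (Quotient.out_eq _).symm

theorem orbitMk_image_openCell_out {n : ℕ} (e : Z.Cell n) :
    Z.orbitMk '' Z.openCell (Quotient.out (Quotient.mk (Z.cellSetoid n) e)) =
      Z.orbitMk '' Z.openCell e := by
  obtain ⟨g, h⟩ := exists_smul_out e
  rw [← h, orbitMk_image_image_smul]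

theorem orbitMk_image_closedCell_out {n : ℕ} (e : Z.Cell n) :
    Z.orbitMk '' RelCWComplex.closedCell n (Quotient.out (Quotient.mk (Z.cellSetoid n) e)) =
      Z.orbitMk '' RelCWComplex.closedCell n e := by
  obtain ⟨g, h⟩ := exists_smul_out e
  rw [← image_smul_closedCell h, orbitMk_image_image_smul]

theorem orbitMk_comp_map_injOn {n : ℕ} (e : Z.Cell n) :
    Set.InjOn (Z.orbitMk ∘ RelCWComplex.map n e) (ball 0 1) :=
  (orbitMk_injOn_openCell e).comp
    ((RelCWComplex.source_eq n e) ▸ (RelCWComplex.map n e).injOn) (Set.mapsTo_image _ _)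

variable (Z) in
/-- The characteristic maps of the space of orbits. -/
noncomputable def orbitCharMap (n : ℕ) (c : Z.OrbitCell n) :
    PartialEquiv (Fin n → ℝ) Z.OrbitSpace :=
  (orbitMk_comp_map_injOn c.out).toPartialEquiv _ _

theorem orbitCharMap_image {n : ℕ} (c : Z.OrbitCell n) (s : Set (Fin n → ℝ)) :
    Z.orbitCharMap n c '' s = Z.orbitMk '' (RelCWComplex.map n c.out '' s) :=
  Set.image_comp Z.orbitMk (RelCWComplex.map n c.out) s

theorem continuousOn_orbitCharMap {n : ℕ} (c : Z.OrbitCell n) :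
    ContinuousOn (Z.orbitCharMap n c) (closedBall 0 1) :=
  isOpenQuotientMap_orbitMk.continuous.comp_continuousOn (RelCWComplex.continuousOn n c.out)

/-- A dimension argument: the sphere lands in cells of dimension below `n`, the open ball in an
`n`-cell, and the action preserves dimension. -/
theorem orbitCharMap_ne {n : ℕ} (c : Z.OrbitCell n) {a b : Fin n → ℝ} (ha : a ∈ sphere 0 1)
    (hb : b ∈ ball 0 1) : Z.orbitCharMap n c a ≠ Z.orbitCharMap n c b := by
  intro h
  have h1 : RelCWComplex.map n c.out a ∈ (CWComplex.skeletonLT (Set.univ : Set Z) n : Set Z) :=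
    RelCWComplex.cellFrontier_subset_skeletonLT n c.out (Set.mem_image_of_mem _ ha)
  rw [← CWComplex.iUnion_openCell_eq_skeletonLT] at h1
  simp only [Set.mem_iUnion] at h1
  obtain ⟨m, hm, e, he⟩ := h1
  obtain ⟨g, e'', -, -, h2⟩ := eq_of_orbitMk_eq (e' := c.out) he (Set.mem_image_of_mem _ hb) h
  have h3 : m = n := congrArg Sigma.fst h2
  exact absurd (Nat.cast_lt.1 hm) (by omega)

/-- On the compact closed ball the characteristic map is closed, as its target is Hausdorff. Since
sphere and open ball have disjoint images, this closedness survives restriction to the open ball. -/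
theorem continuousOn_orbitCharMap_symm [Finite N] {n : ℕ} (c : Z.OrbitCell n) :
    ContinuousOn (Z.orbitCharMap n c).symm (Z.orbitCharMap n c).target := by
  rw [continuousOn_iff_isClosed]
  intro t ht
  refine ⟨Z.orbitCharMap n c '' (closedBall 0 1 ∩ t), ?_, ?_⟩
  · exact (((isCompact_closedBall 0 1).inter_right ht).image_of_continuousOn
      ((continuousOn_orbitCharMap c).mono Set.inter_subset_left)).isClosed
  · ext x
    refine and_congr_left fun hx => ⟨fun h => ?_, ?_⟩
    · exact ⟨_, ⟨ball_subset_closedBall ((Z.orbitCharMap n c).map_target hx), h⟩,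
        (Z.orbitCharMap n c).right_inv hx⟩
    · rintro ⟨a, ⟨ha, hat⟩, rfl⟩
      have hb : (Z.orbitCharMap n c).symm (Z.orbitCharMap n c a) ∈ ball 0 1 :=
        (Z.orbitCharMap n c).map_target hx
      have hab : a ∈ ball 0 1 := by
        by_contra hna
        refine orbitCharMap_ne c ?_ hb ((Z.orbitCharMap n c).right_inv hx).symm
        exact le_antisymm ha (not_lt.1 hna)
      change (Z.orbitCharMap n c).symm (Z.orbitCharMap n c a) ∈ t
      rwa [(Z.orbitCharMap n c).left_inv hab]

variable (Z) in
/-- The space of orbits of a finite group action is a CW-complex. -/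
noncomputable instance orbitCWComplex [Finite N] :
    CWComplex (Set.univ : Set Z.OrbitSpace) where
  cell := Z.OrbitCell
  map := Z.orbitCharMap
  source_eq _ _ := rfl
  continuousOn _ := continuousOn_orbitCharMap
  continuousOn_symm _ := continuousOn_orbitCharMap_symm
  pairwiseDisjoint' := by
    rintro ⟨n, c⟩ - ⟨m, c'⟩ - hne
    rw [Function.onFun, Set.disjoint_left]
    rintro _ ⟨a, ha, rfl⟩ ⟨b, hb, hab⟩
    obtain ⟨g, e'', -, he, h⟩ := eq_of_orbitMk_eq (e := c.out) (e' := c'.out)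
      (Set.mem_image_of_mem _ ha) (Set.mem_image_of_mem _ hb) hab.symm
    obtain rfl : n = m := congrArg Sigma.fst h
    obtain rfl := sigma_mk_injective h
    have h' : c = c' := by
      rw [← Quotient.out_eq c, ← Quotient.out_eq c']
      exact Quotient.sound (s := Z.cellSetoid n) ⟨g, he⟩
    exact hne (h' ▸ rfl)
  mapsTo' n c := by
    classical
    obtain ⟨I, hI⟩ := CWComplex.cellFrontier_subset_finite_closedCell (C := (Set.univ : Set Z)) n
      c.out
    -- The frontier of the representative meets finitely many lower cells upstairs; their classes
    -- cover the frontier downstairs.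
    refine ⟨fun m => (I m).image (Quotient.mk (Z.cellSetoid m)), fun a ha => ?_⟩
    have h := hI (Set.mem_image_of_mem _ ha)
    simp only [Set.mem_iUnion] at h ⊢
    obtain ⟨m, hm, e, he, h⟩ := h
    refine ⟨m, hm, _, Finset.mem_image_of_mem _ he, ?_⟩
    rw [orbitCharMap_image]
    exact (orbitMk_image_closedCell_out e).symm ▸ Set.mem_image_of_mem Z.orbitMk h
  closed' A _ h := by
    -- Closedness downstairs is closedness of the preimage, which the weak topology upstairs tests
    -- cell by cell.
    rw [← isOpenQuotientMap_orbitMk.isQuotientMap.isClosed_preimage]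
    refine (CWComplex.closed (Set.univ : Set Z) _ (Set.subset_univ _)).2 fun n e => ?_
    have h1 := h n (Quotient.mk (Z.cellSetoid n) e)
    rw [orbitCharMap_image] at h1
    have h2 : IsClosed (A ∩ Z.orbitMk '' RelCWComplex.closedCell n e) :=
      orbitMk_image_closedCell_out e ▸ h1
    have h3 := (h2.preimage isOpenQuotientMap_orbitMk.continuous).inter
      (RelCWComplex.isClosed_closedCell (C := (Set.univ : Set Z)) (n := n) (i := e))
    -- The preimage of the image of a closed cell contains its translates too; intersecting with the
    -- cell discards them.
    convert h3 using 1
    ext x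
    exact ⟨fun hx => ⟨⟨hx.1, Set.mem_image_of_mem _ hx.2⟩, hx.2⟩, fun hx => ⟨hx.1.1, hx.2⟩⟩
  union' := by
    refine Set.eq_univ_of_forall fun y => ?_
    obtain ⟨x, rfl⟩ := Quotient.exists_rep y
    have hx : x ∈ ⋃ (n : ℕ) (j : Z.Cell n), RelCWComplex.closedCell n j := by
      rw [CWComplex.union]; trivial
    simp only [Set.mem_iUnion] at hx ⊢
    obtain ⟨n, e, hx⟩ := hx
    refine ⟨n, Quotient.mk _ e, ?_⟩
    rw [orbitCharMap_image]
    exact (orbitMk_image_closedCell_out e).symm ▸ Set.mem_image_of_mem Z.orbitMk hx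

theorem orbitSpace_openCell [Finite N] {n : ℕ} (c : Z.OrbitCell n) :
    RelCWComplex.openCell (C := (Set.univ : Set Z.OrbitSpace)) n c =
      Z.orbitMk '' Z.openCell c.out :=
  orbitCharMap_image c _

end OrbitSpace

/-! ### The quotient by the kernel of a surjection with finite kernel -/

section KerQuotient

variable {G G' : Type u} [Group G] [Group G'] (f : G' →* G) (hf : Function.Surjective f)
  (Y : GCWComplex G')

/-- The projection of `Y` to its space of orbits under the kernel of `f`. -/
def kerMk (y : Y) : (Y.res f.ker.subtype).OrbitSpace := (Y.res f.ker.subtype).orbitMk y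

variable {f Y} in
theorem kerMk_eq_iff {x y : Y} : kerMk f Y x = kerMk f Y y ↔ ∃ g ∈ f.ker, g • x = y :=
  (orbitMk_eq_iff (Z := Y.res f.ker.subtype)).trans
    ⟨fun ⟨g, h⟩ => ⟨g, g.2, h⟩, fun ⟨g, hg, h⟩ => ⟨⟨g, hg⟩, h⟩⟩

theorem isOpenQuotientMap_kerMk : IsOpenQuotientMap (kerMk f Y) :=
  isOpenQuotientMap_orbitMk (Z := Y.res f.ker.subtype)

variable {f Y} in
-- If `z` moves `x` to `y`, then `g' z g⁻¹` moves `g x` to `g' y`, and it lies in the kernel when `f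
-- g = f g'`. This makes the `G`-action on kernel orbits independent of all choices.
theorem kerMk_smul_congr {g g' : G'} (hg : f g = f g') {x y : Y} (h : kerMk f Y x = kerMk f Y y) :
    kerMk f Y (g • x) = kerMk f Y (g' • y) := by
  obtain ⟨z, hz, rfl⟩ := kerMk_eq_iff.1 h
  refine kerMk_eq_iff.2 ⟨g' * z * g⁻¹, ?_, by simp [mul_smul]⟩
  rw [MonoidHom.mem_ker] at hz ⊢
  simp [hz, hg]

/-- The action of `G` on the space of orbits under the kernel of `f : G' → G`. -/
@[reducible]
noncomputable def kerQuotientAction : MulAction G (Y.res f.ker.subtype).OrbitSpace where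
  smul g := Quotient.lift (fun y : Y => kerMk f Y (Function.surjInv hf g • y)) fun _ _ h =>
    kerMk_smul_congr rfl (Quotient.sound h)
  one_smul := by
    rintro ⟨y : Y⟩
    exact (kerMk_smul_congr (g' := 1) (by rw [Function.surjInv_eq hf, map_one])
      rfl).trans (congrArg _ (one_smul G' y))
  mul_smul g h := by
    rintro ⟨y : Y⟩
    exact (kerMk_smul_congr (g' := Function.surjInv hf g * Function.surjInv hf h)
      (by simp only [map_mul, Function.surjInv_eq hf]) rfl).trans (congrArg _ (mul_smul _ _ y))

theorem kerQuotientAction_smul (g : G') (y : Y) :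
    letI := kerQuotientAction f hf Y
    f g • kerMk f Y y = kerMk f Y (g • y) :=
  kerMk_smul_congr (Function.surjInv_eq hf _) rfl

theorem kerQuotientAction_image (g : G') (s : Set Y) :
    letI := kerQuotientAction f hf Y
    (f g • ·) '' (kerMk f Y '' s) = kerMk f Y '' ((g • ·) '' s) := by
  simp only [Set.image_image, kerQuotientAction_smul]

/-- With the next lemma: the cells of the quotient are exactly the images of cells of `Y`, whatever
representatives were chosen. -/
theorem exists_openCell_eq_image_kerMk [Finite f.ker] {n : ℕ} (e : Y.Cell n) :
    ∃ c : RelCWComplex.cell (Set.univ : Set (Y.res f.ker.subtype).OrbitSpace) n,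
      RelCWComplex.openCell n c = kerMk f Y '' Y.openCell e :=
  ⟨_, (orbitSpace_openCell _).trans
    (orbitMk_image_openCell_out (Z := Y.res f.ker.subtype) e)⟩

theorem exists_image_kerMk_eq_openCell [Finite f.ker] {n : ℕ}
    (c : RelCWComplex.cell (Set.univ : Set (Y.res f.ker.subtype).OrbitSpace) n) :
    ∃ e : Y.Cell n, RelCWComplex.openCell n c = kerMk f Y '' Y.openCell e :=
  ⟨_, orbitSpace_openCell c⟩

variable {f Y} in
/-- If the image of a cell is stable under `f(g)`, then a lift of `f(g)` stabilizes the cell. -/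
theorem exists_ker_mul_stabilizes {n : ℕ} {e : Y.Cell n} {g : G'}
    (h : kerMk f Y '' ((g • ·) '' Y.openCell e) = kerMk f Y '' Y.openCell e) :
    ∃ z ∈ f.ker, ((z * g) • ·) '' Y.openCell e = Y.openCell e := by
  obtain ⟨e₁, he₁⟩ := Y.permutes g n e
  obtain ⟨x, hx⟩ := RelCWComplex.openCell_nonempty (C := (Set.univ : Set Y)) n e₁
  -- Some point of the translated cell `e₁ = g e` is kernel-equivalent to a point of `e`; the kernel
  -- element relating them carries `e₁` onto `e`.
  obtain ⟨y, hy, hxy⟩ := h.subset (Set.mem_image_of_mem _ (he₁.symm.subset hx))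
  obtain ⟨z, e₂, -, he₂, h₂⟩ := eq_of_orbitMk_eq (Z := Y.res f.ker.subtype) hx hy hxy.symm
  obtain rfl := sigma_mk_injective h₂
  refine ⟨z, z.2, ?_⟩
  have : ((z * g) • ·) '' Y.openCell e₂ = ((z : G') • ·) '' ((g • ·) '' Y.openCell e₂) := by
    simp only [Set.image_image, mul_smul]
  rw [this]
  exact (congrArg _ he₁).trans he₂

/-- The `G`-CW-complex of orbits under the finite kernel of `f : G' → G`. -/
noncomputable def kerQuotient [Finite f.ker] : GCWComplex G :=
  letI := kerQuotientAction f hf Y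
  { carrier := (Y.res f.ker.subtype).OrbitSpace
    continuous_smul := ⟨fun g => by
      obtain ⟨g, rfl⟩ := hf g
      rw [(isOpenQuotientMap_kerMk f Y).isQuotientMap.continuous_iff]
      exact ((isOpenQuotientMap_kerMk f Y).continuous.comp (continuous_const_smul g)).congr
        fun y => (kerQuotientAction_smul f hf Y g y).symm⟩
    permutes := fun g n c => by
      obtain ⟨g, rfl⟩ := hf g
      obtain ⟨e, hc⟩ := exists_image_kerMk_eq_openCell f Y c
      obtain ⟨e', he⟩ := Y.permutes g n e
      obtain ⟨c', hc'⟩ := exists_openCell_eq_image_kerMk f Y e'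
      exact ⟨c', by rw [hc, hc', kerQuotientAction_image, he]⟩
    fixes := fun g n c h x hx => by
      obtain ⟨g, rfl⟩ := hf g
      obtain ⟨e, hc⟩ := exists_image_kerMk_eq_openCell f Y c
      rw [hc, kerQuotientAction_image] at h
      rw [hc] at hx
      obtain ⟨y, hy, rfl⟩ := hx
      -- The corrected lift `zg` stabilizes `e`, hence fixes `y`; so `g y` and `y` lie in one kernel
      -- orbit.
      obtain ⟨z, hz, he⟩ := exists_ker_mul_stabilizes h
      rw [kerQuotientAction_smul]
      refine kerMk_eq_iff.2 ⟨z, hz, ?_⟩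
      rw [← mul_smul]
      exact Y.fixes _ n e he y hy }

/-- The projection `Y → Y/ker f`. -/
noncomputable def kerProj [Finite f.ker] : C(Y, kerQuotient f hf Y) :=
  ⟨kerMk f Y, (isOpenQuotientMap_kerMk f Y).continuous⟩

theorem isQuotientMap_kerProj [Finite f.ker] : IsQuotientMap (kerProj f hf Y) :=
  (isOpenQuotientMap_kerMk f Y).isQuotientMap

theorem kerProj_smul [Finite f.ker] (g : G') (y : Y) :
    kerProj f hf Y (g • y) = f g • kerProj f hf Y y :=
  (kerQuotientAction_smul f hf Y g y).symm

/-- The stabilizer of an image cell lies in the image under `f` of the stabilizer of the cell above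
it. -/
theorem IsProper.kerQuotient [Finite f.ker] (hY : Y.IsProper) :
    (kerQuotient f hf Y).IsProper := fun n c => by
  obtain ⟨e, hc⟩ := exists_image_kerMk_eq_openCell f Y c
  refine ((hY n e).image f).subset fun g hg => ?_
  obtain ⟨g, rfl⟩ := hf g
  have hg' : _ = _ := hg
  have h : kerMk f Y '' ((g • ·) '' Y.openCell e) = kerMk f Y '' Y.openCell e := by
    rw [← kerQuotientAction_image f hf Y, ← hc]
    exact hg'
  obtain ⟨z, hz, he⟩ := exists_ker_mul_stabilizes h
  exact ⟨z * g, he, by rw [map_mul, show f z = 1 from hz, one_mul]⟩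

end KerQuotient

/-! ### Restriction of models along surjections with finite kernel -/

section Model

variable {G G' : Type u} [Group G] [Group G'] {f : G' →* G} (hf : Function.Surjective f)
  [Finite f.ker] {X : GCWComplex G} {Y : GCWComplex G'}

/-- Stabilizers for the restricted action are preimages under `f` of finite sets. -/
theorem IsProper.res (hX : X.IsProper) : (X.res f).IsProper := fun n e =>
  finite_preimage f (hX n e)

/-- A `G`-map `Y/ker f → X` gives a `G'`-map `Y → X`. -/
noncomputable def Map.compKerProj (φ : Map (kerQuotient f hf Y) X) : Map Y (X.res f) where
  toFun := φ.toFun.comp (kerProj f hf Y)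
  map_smul g y := (congrArg φ.toFun (kerProj_smul f hf Y g y)).trans (φ.map_smul _ _)

theorem Map.toFun_injective {Y X : GCWComplex G} :
    Function.Injective (Map.toFun : Map Y X → C(Y, X)) := by
  rintro ⟨φ, _⟩ ⟨ψ, _⟩ rfl
  rfl

/-- The kernel acts trivially on the target, so the map is constant on kernel orbits and descends
along the quotient map. -/
theorem Map.exists_eq_compKerProj (ψ : Map Y (X.res f)) :
    ∃ φ : Map (kerQuotient f hf Y) X, φ.compKerProj hf = ψ := by
  let p : C(Y, X) := ψ.toFun
  have hp (g : G') (y : Y) : p (g • y) = f g • p y := ψ.map_smul g y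
  have hker (x y : Y) (h : kerProj f hf Y x = kerProj f hf Y y) : p x = p y := by
    obtain ⟨z, hz, rfl⟩ := kerMk_eq_iff.1 h
    rw [hp, show f z = 1 from hz, one_smul]
  have hq := isQuotientMap_kerProj f hf Y
  have hl (y : Y) : hq.lift p hker (kerProj f hf Y y) = p y :=
    DFunLike.congr_fun (hq.lift_comp p hker) y
  refine ⟨⟨hq.lift p hker, fun g y => ?_⟩, ?_⟩
  · obtain ⟨g, rfl⟩ := hf g
    obtain ⟨y, rfl⟩ := hq.surjective y
    rw [← kerProj_smul, hl, hl, hp]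
  · exact Map.toFun_injective (hq.lift_comp p hker)

/-- Homotopies need only be pulled back to `Y`, never descended, so the product of the projection
with the interval need not be examined as a quotient map. -/
theorem Map.Homotopic.compKerProj {φ φ' : Map (kerQuotient f hf Y) X} (h : φ.Homotopic φ') :
    (φ.compKerProj hf).Homotopic (φ'.compKerProj hf) := by
  obtain ⟨F, hF⟩ := h
  refine ⟨F.comp (.refl (kerProj f hf Y)), fun g t y => ?_⟩
  exact (congrArg (fun z => F (t, z)) (kerProj_smul f hf Y g y)).trans (hF _ _ _)

/-- Existence and uniqueness both transfer because every `G'`-map from `Y` comes from a `G`-map out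
of the proper complex `Y/ker f`. -/
theorem IsModel.res (hf : Function.Surjective f) (hX : X.IsModel) : (X.res f).IsModel := by
  refine ⟨hX.1.res, fun Y hY => ?_⟩
  obtain ⟨φ, hφ⟩ := hX.2 (kerQuotient f hf Y) (hY.kerQuotient f hf Y)
  refine ⟨φ.compKerProj hf, fun ψ => ?_⟩
  obtain ⟨ψ, rfl⟩ := ψ.exists_eq_compKerProj hf
  exact (hφ ψ).compKerProj hf

end Model

end GCWComplex

end Bredon

/-! ### The theorem, from the restriction of models and the cochain isomorphism. -/

theorem theorem4p2 {G : Type u} [Group G] (n : ℕ) (hn : 0 < n) (α : Bredon.Cocycle G)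
    (hα : α.ValuesIn n) (X : Bredon.GCWComplex G) (hX : X.IsModel) :
    (X.res (Bredon.CentralExt.proj hα)).IsModel ∧
      ∀ i : ℕ, IsIso (Bredon.rhoCohomology hα X i) := by
  have := Bredon.CentralExt.finite_ker_proj hn hα
  have := Bredon.isIso_rhoCochains hα X
  exact ⟨hX.res (Bredon.CentralExt.isCentralExtension hα).2.1,
    fun i => inferInstanceAs (IsIso (HomologicalComplex.homologyMap _ i))⟩
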